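/- Let $M$ be a smooth (finite-dimensional) manifold and let $A\subset TM\setminus\mathbf 0$ be an open subset which is conic, that is, $\pi(A)=M$ and $cv\in A$ for all $v\in A$, $c>0$. A pseudo-Finsler metric on $M$ with domain $A$ is a smooth function $L:A\to\mathbb R$ with $L(cv)=c^2L(v)$ for $v\in A$, $c>0$, whose fundamental tensor $g_v(u,w)=\frac12\frac{\partial^2}{\partial t\,\partial s}L(v+tu+sw)|_{t=s=0}$ is nondegenerate for every $v\in A$; its Cartan tensor is $C_v(w_1,w_2,w_3)=\frac14\frac{\partial^3}{\partial s_3\partial s_2\partial s_1}L(v+\sum_i s_iw_i)|_{s_1=s_2=s_3=0}$. The Chern connection of $L$ is the unique anisotropic connection $\nabla$, $(v,X,Y)\mapsto\nabla^v_XY\in T_{\pi(v)}M$ for $v\in A$ (additive in $Y$, satisfying the Leibniz rule in $Y$, function-linear in $X$, and smooth in $v$), such that for every vector field $V$ with values in $A$ on an open set $\Omega\subset M$ the affine connection $(\nabla^V_XY)_p=\nabla^{V_p}_XY$ satisfies $\nabla^V_XY-\nabla^V_YX=[X,Y]$ and $X(g_V(Y,Z))=g_V(\nabla^V_XY,Z)+g_V(Y,\nabla^V_XZ)+2C_V(\nabla^V_XV,Y,Z)$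 for all vector fields $X,Y,Z$ on $\Omega$. For a smooth curve $\gamma:[a,b]\to M$, $a<b$, and vector fields $U,X$ along $\gamma$, $U$ with values in $A$, it induces the covariant derivative $D^U_\gamma X$, given in a chart by $\bigl(\dot X^k+X^i\dot\gamma^j\,\Gamma^k_{ij}(U)\bigr)\partial_k$, where $\nabla^v_{\partial_i}\partial_j=\Gamma^k_{ij}(v)\partial_k$. A smooth curve $\gamma:[a,b]\to M$ is admissible if $\dot\gamma(t)\in A$ for all $t\in[a,b]$; an admissible smooth curve is lightlike for $L$ if $L(\dot\gamma(t))=0$ for all $t$, and it is a geodesic of $(M,L)$ if $D^{\dot\gamma}_\gamma\dot\gamma=0$. Proposition 3.2. Let $L:A\to\mathbb R$ be a pseudo-Finsler metric on $M$ and let $\lambda:A\to(0,+\infty)$ be a smooth function, positively homogeneous of degree $0$, such that $\lambda L$ is also a pseudo-Finsler metric with domain $A$. Let $D$ be the covariant derivative induced by the Chern connection of $L$. Then a curve $\gamma:[a,b]\to M$ is a lightlike geodesic of $(M,\lambda L)$ (that is, it is a geodesic for the Chern connection of $\lambda L$ and $\lambda L$ vanishes on $\dot\gamma$) if and only if it is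 a smooth admissible lightlike curve of $(M,L)$ satisfying $$D^{\dot\gamma}_{\gamma}\bigl(\lambda(\dot\gamma)\,\dot\gamma\bigr)=0\quad\text{on }[a,b].$$ -/

import Mathlib

open Set Filter Topology Manifold ContDiff Bundle

namespace PseudoFinsler

section Defs
variable {E : Type*} [NormedAddCommGroup E] [NormedSpace ℝ E]
  {M : Type*} [TopologicalSpace M] [ChartedSpace E M] [IsManifold 𝓘(ℝ, E) ∞ M]

/-- An open conic subset of the tangent bundle which avoids the zero section and projects onto
the manifold. -/
structure IsConicDomain (A : Set (TangentBundle 𝓘(ℝ, E) M)) : Prop where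
  isOpen : IsOpen A
  ne_zero : ∀ v ∈ A, v.2 ≠ 0
  exists_mem : ∀ p : M, ∃ v ∈ A, v.proj = p
  smul_mem : ∀ v ∈ A, ∀ c : ℝ, 0 < c → (⟨v.1, c • v.2⟩ : TangentBundle 𝓘(ℝ, E) M) ∈ A

/-- The fundamental tensor `g_v(u, w)`, half the mixed second derivative of
`(t, s) ↦ L (v + t u + s w)` at the origin. -/
noncomputable def fundamentalTensor (L : TangentBundle 𝓘(ℝ, E) M → ℝ)
    (v : TangentBundle 𝓘(ℝ, E) M) (u w : TangentSpace 𝓘(ℝ, E) v.1) : ℝ :=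
  1 / 2 * deriv (fun t : ℝ => deriv (fun s : ℝ => L ⟨v.1, v.2 + t • u + s • w⟩) 0) 0

/-- The Cartan tensor `C_v(w₁, w₂, w₃)`, a quarter of the mixed third derivative of
`L (v + s₁ w₁ + s₂ w₂ + s₃ w₃)` at the origin. -/
noncomputable def cartanTensor (L : TangentBundle 𝓘(ℝ, E) M → ℝ)
    (v : TangentBundle 𝓘(ℝ, E) M) (w₁ w₂ w₃ : TangentSpace 𝓘(ℝ, E) v.1) : ℝ :=
  1 / 4 * deriv (fun s₃ : ℝ => deriv (fun s₂ : ℝ => deriv (fun s₁ : ℝ =>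
    L ⟨v.1, v.2 + s₁ • w₁ + s₂ • w₂ + s₃ • w₃⟩) 0) 0) 0

/-- `L` is a (conic, two-homogeneous) pseudo-Finsler metric with domain `A`. Only the restriction
of the function `L` to the open set `A` matters. -/
structure IsPseudoFinsler (A : Set (TangentBundle 𝓘(ℝ, E) M))
    (L : TangentBundle 𝓘(ℝ, E) M → ℝ) : Prop where
  conic : IsConicDomain A
  smooth : ContMDiffOn 𝓘(ℝ, E).tangent 𝓘(ℝ, ℝ) ∞ L A
  homog : ∀ v ∈ A, ∀ c : ℝ, 0 < c → L ⟨v.1, c • v.2⟩ = c ^ 2 * L v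
  nondegenerate : ∀ v ∈ A, ∀ u : TangentSpace 𝓘(ℝ, E) v.1,
    (∀ w : TangentSpace 𝓘(ℝ, E) v.1, fundamentalTensor L v u w = 0) → u = 0

/-- `X` restricts to a smooth vector field on the open set `Ω`. -/
structure IsVectorFieldOn (Ω : Set M) (X : ∀ q : M, TangentSpace 𝓘(ℝ, E) q) : Prop where
  isOpen : IsOpen Ω
  smooth : ContMDiffOn 𝓘(ℝ, E) 𝓘(ℝ, E).tangent ∞
    (fun q => (⟨q, X q⟩ : TangentBundle 𝓘(ℝ, E) M)) Ω

/-- An anisotropic (linear) connection on `A`: `toFun v X Y` is `∇_X^v Y`. Since the Chern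
connection is tested on fields that are only defined on open sets, all the axioms are stated for
vector fields and functions on an arbitrary open set `Ω` containing the base point; the axioms
make `∇_X^v Y` depend only on the germs of `X` and `Y` at the base point of `v`. The values at
`v ∉ A`, or on fields which are not smooth near the base point, are irrelevant. -/
structure AnisotropicConnection (A : Set (TangentBundle 𝓘(ℝ, E) M)) where
  toFun : ∀ v : TangentBundle 𝓘(ℝ, E) M, (∀ q : M, TangentSpace 𝓘(ℝ, E) q) →
    (∀ q : M, TangentSpace 𝓘(ℝ, E) q) → TangentSpace 𝓘(ℝ, E) v.1
  add_right : ∀ (Ω : Set M) (X Y Z : ∀ q : M, TangentSpace 𝓘(ℝ, E) q), IsVectorFieldOn Ω X →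
    IsVectorFieldOn Ω Y → IsVectorFieldOn Ω Z → ∀ v ∈ A, v.1 ∈ Ω →
      toFun v X (fun q => Y q + Z q) = toFun v X Y + toFun v X Z
  leibniz : ∀ (Ω : Set M) (f : M → ℝ) (X Y : ∀ q : M, TangentSpace 𝓘(ℝ, E) q),
    ContMDiffOn 𝓘(ℝ, E) 𝓘(ℝ, ℝ) ∞ f Ω → IsVectorFieldOn Ω X → IsVectorFieldOn Ω Y →
    ∀ v ∈ A, v.1 ∈ Ω →
      toFun v X (fun q => f q • Y q) =
        mvfderiv 𝓘(ℝ, E) f v.1 (X v.1) • Y v.1 + f v.1 • toFun v X Y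
  smooth : ∀ (Ω : Set M) (X Y : ∀ q : M, TangentSpace 𝓘(ℝ, E) q), IsVectorFieldOn Ω X →
    IsVectorFieldOn Ω Y → ContMDiffOn 𝓘(ℝ, E).tangent 𝓘(ℝ, E).tangent ∞
      (fun v => (⟨v.1, toFun v X Y⟩ : TangentBundle 𝓘(ℝ, E) M)) {v | v ∈ A ∧ v.1 ∈ Ω}
  linear_left : ∀ (Ω : Set M) (f h : M → ℝ) (X Y Z : ∀ q : M, TangentSpace 𝓘(ℝ, E) q),
    ContMDiffOn 𝓘(ℝ, E) 𝓘(ℝ, ℝ) ∞ f Ω → ContMDiffOn 𝓘(ℝ, E) 𝓘(ℝ, ℝ) ∞ h Ω →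
    IsVectorFieldOn Ω X → IsVectorFieldOn Ω Y → IsVectorFieldOn Ω Z → ∀ v ∈ A, v.1 ∈ Ω →
      toFun v (fun q => f q • X q + h q • Y q) Z = f v.1 • toFun v X Z + h v.1 • toFun v Y Z

/-- `nab` is the Chern connection of `L`: for every `A`-admissible field `V` on an open set `Ω` the
affine connection `∇^V` on `Ω`, `(∇_X^V Y)_p = ∇_X^{V_p} Y`, is torsion free and almost
`g`-compatible. -/
structure IsChernConnection {A : Set (TangentBundle 𝓘(ℝ, E) M)}
    (L : TangentBundle 𝓘(ℝ, E) M → ℝ) (nab : AnisotropicConnection A) : Prop where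
  torsionFree : ∀ (Ω : Set M) (V X Y : ∀ q : M, TangentSpace 𝓘(ℝ, E) q),
    IsVectorFieldOn Ω V → (∀ q ∈ Ω, (⟨q, V q⟩ : TangentBundle 𝓘(ℝ, E) M) ∈ A) →
    IsVectorFieldOn Ω X → IsVectorFieldOn Ω Y → ∀ p ∈ Ω,
      nab.toFun ⟨p, V p⟩ X Y - nab.toFun ⟨p, V p⟩ Y X = VectorField.mlieBracket 𝓘(ℝ, E) X Y p
  almostCompatible : ∀ (Ω : Set M) (V X Y Z : ∀ q : M, TangentSpace 𝓘(ℝ, E) q),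
    IsVectorFieldOn Ω V → (∀ q ∈ Ω, (⟨q, V q⟩ : TangentBundle 𝓘(ℝ, E) M) ∈ A) →
    IsVectorFieldOn Ω X → IsVectorFieldOn Ω Y → IsVectorFieldOn Ω Z → ∀ p ∈ Ω,
      mvfderiv 𝓘(ℝ, E) (fun q => fundamentalTensor L ⟨q, V q⟩ (Y q) (Z q)) p (X p) =
        fundamentalTensor L ⟨p, V p⟩ (nab.toFun ⟨p, V p⟩ X Y) (Z p) +
        fundamentalTensor L ⟨p, V p⟩ (Y p) (nab.toFun ⟨p, V p⟩ X Z) +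
        2 * cartanTensor L ⟨p, V p⟩ (nab.toFun ⟨p, V p⟩ X V) (Y p) (Z p)
end Defs

/-! ### Auxiliary facts: fundamental and Cartan tensors in coordinates -/

section Local
set_option maxSynthPendingDepth 3
set_option linter.unusedSectionVars false

variable {E : Type*} [NormedAddCommGroup E] [NormedSpace ℝ E]

lemma two_le_inf : (2 : WithTop ℕ∞) ≤ ∞ := by
  exact WithTop.coe_le_coe.2 (le_top : (2 : ℕ∞) ≤ ⊤)

lemma hasDerivAt_line {F : Type*} [NormedAddCommGroup F] [NormedSpace ℝ F] {f : E × E → F}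
    {x v w : E} (hf : DifferentiableAt ℝ f (x, v)) :
    HasDerivAt (fun s : ℝ => f (x, v + s • w)) (fderiv ℝ f (x, v) (0, w)) 0 := by
  have h1 : HasDerivAt (fun s : ℝ => ((x, v + s • w) : E × E)) (0, w) 0 := by
    have := ((hasDerivAt_id (0 : ℝ)).smul_const w).const_add v
    simpa using (hasDerivAt_const (0 : ℝ) x).prodMk this
  have h2 : HasFDerivAt f (fderiv ℝ f (x, v)) (x, v + (0 : ℝ) • w) := by
    simpa using hf.hasFDerivAt
  exact h2.comp_hasDerivAt (0 : ℝ) h1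

lemma eventually_line {S : Set (E × E)} (hS : IsOpen S) {x v w : E} (h : (x, v) ∈ S) :
    ∀ᶠ t : ℝ in 𝓝 0, (x, v + t • w) ∈ S := by
  have : Continuous fun t : ℝ => ((x, v + t • w) : E × E) := by fun_prop
  exact this.continuousAt.eventually_mem (hS.mem_nhds (by simpa using h))

section
variable {l : E × E → ℝ} {S : Set (E × E)}

lemma cd1 (hS : IsOpen S) (hl : ContDiffOn ℝ ∞ l S) : ContDiffOn ℝ ∞ (fderiv ℝ l) S := hl.fderiv_of_isOpen hS (by simp)
lemma cd2 (hS : IsOpen S) (hl : ContDiffOn ℝ ∞ l S) : ContDiffOn ℝ ∞ (fderiv ℝ (fderiv ℝ l)) S := (cd1 hS hl).fderiv_of_isOpen hS (by simp)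

lemma diff_of {F : Type*} [NormedAddCommGroup F] [NormedSpace ℝ F] {f : E × E → F}
    (hS : IsOpen S) (hf : ContDiffOn ℝ ∞ f S) {z : E × E} (hz : z ∈ S) :
    DifferentiableAt ℝ f z :=
  (hf.differentiableOn (by simp)).differentiableAt (hS.mem_nhds hz)

lemma deriv2 (hS : IsOpen S) (hl : ContDiffOn ℝ ∞ l S) {x v : E} (h : (x, v) ∈ S) (u w : E) :
    deriv (fun t : ℝ => deriv (fun s : ℝ => l (x, v + t • u + s • w)) 0) 0 =
      fderiv ℝ (fderiv ℝ l) (x, v) (0, u) (0, w) := by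
  have : (fun t : ℝ => deriv (fun s : ℝ => l (x, v + t • u + s • w)) 0) =ᶠ[𝓝 0]
      fun t => fderiv ℝ l (x, v + t • u) (0, w) := by
    filter_upwards [eventually_line hS (w := u) h] with t ht
    exact (hasDerivAt_line (diff_of hS hl ht)).deriv
  rw [this.deriv_eq]
  exact ((hasDerivAt_line (w := u) (diff_of hS (cd1 hS hl) h)).clm_apply
    (hasDerivAt_const (0 : ℝ) ((0, w) : E × E))).deriv.trans (by simp)

lemma deriv3 (hS : IsOpen S) (hl : ContDiffOn ℝ ∞ l S) {x v : E} (h : (x, v) ∈ S) (a b c : E) :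
    deriv (fun s₃ : ℝ => deriv (fun s₂ : ℝ => deriv (fun s₁ : ℝ =>
      l (x, v + s₁ • a + s₂ • b + s₃ • c)) 0) 0) 0 =
      fderiv ℝ (fderiv ℝ (fderiv ℝ l)) (x, v) (0, c) (0, b) (0, a) := by
  have : (fun s₃ : ℝ => deriv (fun s₂ : ℝ => deriv (fun s₁ : ℝ =>
      l (x, v + s₁ • a + s₂ • b + s₃ • c)) 0) 0) =ᶠ[𝓝 0]
      fun t => fderiv ℝ (fderiv ℝ l) (x, v + t • c) (0, b) (0, a) := by
    filter_upwards [eventually_line hS (w := c) h] with t ht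
    rw [← deriv2 hS hl ht]
    congr 1; ext s; congr 1; ext r
    congr 2; abel
  rw [this.deriv_eq]
  exact (((hasDerivAt_line (w := c) (diff_of hS (cd2 hS hl) h)).clm_apply
    (hasDerivAt_const (0 : ℝ) ((0, b) : E × E))).clm_apply
    (hasDerivAt_const (0 : ℝ) ((0, a) : E × E))).deriv.trans (by simp)
end

/-- The fundamental tensor in coordinates. -/
noncomputable def locG (l : E × E → ℝ) (z : E × E) : E →L[ℝ] E →L[ℝ] ℝ :=
  (1 / 2 : ℝ) • (fderiv ℝ (fderiv ℝ l) z).bilinearComp (ContinuousLinearMap.inr ℝ E E)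
    (ContinuousLinearMap.inr ℝ E E)

lemma locG_apply (l : E × E → ℝ) (z : E × E) (y w : E) :
    locG l z y w = 1 / 2 * fderiv ℝ (fderiv ℝ l) z (0, y) (0, w) := by
  simp [locG]

section
variable {l : E × E → ℝ} {S : Set (E × E)}

lemma locG_smooth [FiniteDimensional ℝ E] (hS : IsOpen S) (hl : ContDiffOn ℝ ∞ l S) : ContDiffOn ℝ ∞ (locG l) S := by
  rw [contDiffOn_clm_apply]; intro y
  rw [contDiffOn_clm_apply]; intro w
  simp only [locG_apply]
  exact contDiffOn_const.mul (((cd2 hS hl).clm_apply contDiffOn_const).clm_apply contDiffOn_const)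

lemma locK_apply [FiniteDimensional ℝ E] (hS : IsOpen S) (hl : ContDiffOn ℝ ∞ l S) {z : E × E} (hz : z ∈ S) (ζ : E × E) (y w : E) :
    fderiv ℝ (locG l) z ζ y w =
      1 / 2 * fderiv ℝ (fderiv ℝ (fderiv ℝ l)) z ζ (0, y) (0, w) := by
  have h1 := (((diff_of hS (locG_smooth hS hl) hz).hasFDerivAt.clm_apply
    (hasFDerivAt_const y z)).clm_apply (hasFDerivAt_const w z))
  have h2 := ((((diff_of hS (cd2 hS hl) hz).hasFDerivAt.clm_apply
    (hasFDerivAt_const ((0, y) : E × E) z)).clm_apply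
      (hasFDerivAt_const ((0, w) : E × E) z))).const_mul (1 / 2 : ℝ)
  simp only [← locG_apply] at h2
  have := DFunLike.congr_fun (h1.unique h2) ζ
  simpa using this

lemma locH_symm (hS : IsOpen S) (hl : ContDiffOn ℝ ∞ l S) {z : E × E} (hz : z ∈ S) (a b : E × E) :
    fderiv ℝ (fderiv ℝ l) z a b = fderiv ℝ (fderiv ℝ l) z b a :=
  ((hl.contDiffAt (hS.mem_nhds hz)).isSymmSndFDerivAt (by simp; exact two_le_inf)) a b

lemma loc3_symm12 (hS : IsOpen S) (hl : ContDiffOn ℝ ∞ l S) {z : E × E} (hz : z ∈ S) (a b c : E × E) :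
    fderiv ℝ (fderiv ℝ (fderiv ℝ l)) z a b c = fderiv ℝ (fderiv ℝ (fderiv ℝ l)) z b a c := by
  have := (((cd1 hS hl).contDiffAt (hS.mem_nhds hz)).isSymmSndFDerivAt (by simp; exact two_le_inf)) a b
  rw [this]

lemma loc3_symm23 (hS : IsOpen S) (hl : ContDiffOn ℝ ∞ l S) {z : E × E} (hz : z ∈ S) (a b c : E × E) :
    fderiv ℝ (fderiv ℝ (fderiv ℝ l)) z a b c = fderiv ℝ (fderiv ℝ (fderiv ℝ l)) z a c b := by
  have h (b c : E × E) := (((diff_of hS (cd2 hS hl) hz).hasFDerivAt.clm_apply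
    (hasFDerivAt_const b z)).clm_apply (hasFDerivAt_const c z))
  have e : (fun z => fderiv ℝ (fderiv ℝ l) z b c) =ᶠ[𝓝 z]
      fun z => fderiv ℝ (fderiv ℝ l) z c b := by
    filter_upwards [hS.mem_nhds hz] with y hy using locH_symm hS hl hy b c
  have := DFunLike.congr_fun ((h b c).unique ((h c b).congr_of_eventuallyEq e)) a
  simpa using this

lemma euler1 (hS : IsOpen S) (hl : ContDiffOn ℝ ∞ l S) (hh : ∀ z ∈ S, ∀ c : ℝ, 0 < c → l (z.1, c • z.2) = c ^ 2 * l z) {z : E × E}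
    (hz : z ∈ S) : fderiv ℝ l z (0, z.2) = 2 * l z := by
  obtain ⟨x, v⟩ := z
  have h1 := hasDerivAt_line (w := v) (diff_of hS hl hz)
  have h2 : (fun s : ℝ => l (x, v + s • v)) =ᶠ[𝓝 0] fun s => (1 + s) ^ 2 * l (x, v) := by
    filter_upwards [lt_mem_nhds (show (-1 : ℝ) < 0 by norm_num)] with s hs
    rw [← hh _ hz _ (by linarith)]
    simp [add_smul]
  have h3 : HasDerivAt (fun s : ℝ => (1 + s) ^ 2 * l (x, v)) (2 * l (x, v)) 0 := by
    have := ((((hasDerivAt_id (0 : ℝ)).const_add 1).pow 2).mul_const (l (x, v)))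
    simpa using this
  exact h1.unique (h3.congr_of_eventuallyEq h2)

lemma euler2 (hS : IsOpen S) (hl : ContDiffOn ℝ ∞ l S) (hh : ∀ z ∈ S, ∀ c : ℝ, 0 < c → l (z.1, c • z.2) = c ^ 2 * l z) {z : E × E}
    (hz : z ∈ S) (y : E) : fderiv ℝ (fderiv ℝ l) z (0, y) (0, z.2) = fderiv ℝ l z (0, y) := by
  have hd : HasFDerivAt (fun z : E × E => ((0, z.2) : E × E))
      ((ContinuousLinearMap.inr ℝ E E).comp (ContinuousLinearMap.snd ℝ E E)) z :=
    ((ContinuousLinearMap.inr ℝ E E).comp (ContinuousLinearMap.snd ℝ E E)).hasFDerivAt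
  have h1 := (diff_of hS (cd1 hS hl) hz).hasFDerivAt.clm_apply hd
  have h2 := (diff_of hS hl hz).hasFDerivAt.const_mul (2 : ℝ)
  have e : (fun z : E × E => fderiv ℝ l z (0, z.2)) =ᶠ[𝓝 z] fun z => 2 * l z := by
    filter_upwards [hS.mem_nhds hz] with y hy using euler1 hS hl hh hy
  have := DFunLike.congr_fun (h1.unique (h2.congr_of_eventuallyEq e)) (0, y)
  simp at this
  linarith

lemma euler3 (hS : IsOpen S) (hl : ContDiffOn ℝ ∞ l S) (hh : ∀ z ∈ S, ∀ c : ℝ, 0 < c → l (z.1, c • z.2) = c ^ 2 * l z) {z : E × E}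
    (hz : z ∈ S) (w y : E) :
    fderiv ℝ (fderiv ℝ (fderiv ℝ l)) z (0, w) (0, y) (0, z.2) = 0 := by
  have hd : HasFDerivAt (fun z : E × E => ((0, z.2) : E × E))
      ((ContinuousLinearMap.inr ℝ E E).comp (ContinuousLinearMap.snd ℝ E E)) z :=
    ((ContinuousLinearMap.inr ℝ E E).comp (ContinuousLinearMap.snd ℝ E E)).hasFDerivAt
  have h1 := ((diff_of hS (cd2 hS hl) hz).hasFDerivAt.clm_apply
    (hasFDerivAt_const ((0, y) : E × E) z)).clm_apply hd
  have h2 := (diff_of hS (cd1 hS hl) hz).hasFDerivAt.clm_apply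
    (hasFDerivAt_const ((0, y) : E × E) z)
  have e : (fun z : E × E => fderiv ℝ (fderiv ℝ l) z (0, y) (0, z.2)) =ᶠ[𝓝 z]
      fun z => fderiv ℝ l z (0, y) := by
    filter_upwards [hS.mem_nhds hz] with y hy using euler2 hS hl hh hy _
  have := DFunLike.congr_fun (h1.unique (h2.congr_of_eventuallyEq e)) (0, w)
  simp at this
  rw [locH_symm hS hl hz (0, w) (0, y)] at this
  linarith
end

/-! Algebra of the Chern symbols. -/
section Alg
variable (g : E →L[ℝ] E →L[ℝ] ℝ) (k : E × E →L[ℝ] E →L[ℝ] E →L[ℝ] ℝ) (v : E)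

/-- The part of the derivative of the fundamental tensor along the base. -/
noncomputable def kx : E →L[ℝ] E →L[ℝ] E →L[ℝ] ℝ := k.comp (ContinuousLinearMap.inl ℝ E E)
/-- The part of the derivative of the fundamental tensor along the fibre. -/
noncomputable def kv : E →L[ℝ] E →L[ℝ] E →L[ℝ] ℝ := k.comp (ContinuousLinearMap.inr ℝ E E)
/-- The spray in coordinates. -/
noncomputable def spr : E :=
  g.inverse (kx k v v - (1 / 2 : ℝ) • ((kx k).flip v).flip v)
/-- The nonlinear connection in coordinates. -/
noncomputable def nl : E →L[ℝ] E :=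
  g.inverse.comp ((1 / 2 : ℝ) •
    ((kx k).flip v + kx k v - ((kx k).flip v).flip - kv k (spr g k v)))
/-- The Christoffel symbols of the Chern connection in coordinates. -/
noncomputable def chr (X Y : E) : E :=
  g.inverse ((1 / 2 : ℝ) • (kx k X Y + kx k Y X - ((kx k).flip X).flip Y
    - kv k (nl g k v X) Y - kv k (nl g k v Y) X + (kv k X Y).comp (nl g k v)))

@[simp] lemma kx_apply (X : E) : kx k X = k (X, 0) := by simp [kx]
@[simp] lemma kv_apply (X : E) : kv k X = k (0, X) := by simp [kv]

variable {g k v}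
lemma nondeg_inv [FiniteDimensional ℝ E] (hnd : ∀ u, (∀ w, g u w = 0) → u = 0) :
    g.IsInvertible := by
  have hinj : Function.Injective (g : E →ₗ[ℝ] (E →L[ℝ] ℝ)) := by
    rw [← LinearMap.ker_eq_bot, LinearMap.ker_eq_bot']
    intro u hu
    exact hnd u fun w => by
      have := DFunLike.congr_fun (show g u = 0 from hu) w
      simpa using this
  have hdim : Module.finrank ℝ E = Module.finrank ℝ (E →L[ℝ] ℝ) := by
    rw [← (LinearMap.toContinuousLinearMap (𝕜 := ℝ) (E := E) (F' := ℝ)).finrank_eq]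
    exact (Subspace.dual_finrank_eq (K := ℝ) (V := E)).symm
  let e := LinearEquiv.ofInjectiveOfFinrankEq (g : E →ₗ[ℝ] (E →L[ℝ] ℝ)) hinj hdim
  refine ⟨e.toContinuousLinearEquiv, ?_⟩
  ext u w
  rfl


lemma g_inv (hg : g.IsInvertible)
    (ξ : E →L[ℝ] ℝ) (w : E) : g (g.inverse ξ) w = ξ w := by
  obtain ⟨e, rfl⟩ := hg
  simp

lemma g_spr (hg : g.IsInvertible)
    (Z : E) : g (spr g k v) Z = k (v, 0) v Z - 1 / 2 * k (Z, 0) v v := by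
  simp [spr, g_inv hg]

lemma g_nl (hg : g.IsInvertible)
    (X Z : E) : 2 * g (nl g k v X) Z = k (X, 0) v Z + k (v, 0) X Z - k (Z, 0) v X
    - k (0, spr g k v) X Z := by
  simp [nl, g_inv hg]

lemma g_chr (hg : g.IsInvertible)
    (X Y Z : E) : 2 * g (chr g k v X Y) Z = k (X, 0) Y Z + k (Y, 0) X Z - k (Z, 0) X Y
    - k (0, nl g k v X) Y Z - k (0, nl g k v Y) X Z + k (0, X) Y (nl g k v Z) := by
  simp [chr, g_inv hg]
  ring

lemma eq_of_g (hg : g.IsInvertible)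
    {a b : E} (h : ∀ Z, g a Z = g b Z) : a = b := by
  obtain ⟨e, rfl⟩ := hg
  apply e.injective
  ext Z
  exact h Z

lemma nl_self (hg : g.IsInvertible) (ks : ∀ ζ a b, k ζ a b = k ζ b a) (kv0 : ∀ a b, k (0, a) b v = 0)
    : nl g k v v = spr g k v := by
  refine eq_of_g hg fun Z => ?_
  have h1 := g_nl (k := k) (v := v) hg v Z
  have h2 := g_spr (k := k) (v := v) hg Z
  have h3 := kv0 (spr g k v) Z
  have h4 := ks (0, spr g k v) v Z
  linarith

lemma chr_v (hg : g.IsInvertible) (ks : ∀ ζ a b, k ζ a b = k ζ b a) (kv0 : ∀ a b, k (0, a) b v = 0)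
    (X : E) : chr g k v X v = nl g k v X := by
  refine eq_of_g hg fun Z => ?_
  have h1 := g_chr (k := k) (v := v) hg X v Z
  have h2 := g_nl (k := k) (v := v) hg X Z
  have h3 := ks (0, nl g k v X) v Z
  have h4 := kv0 (nl g k v X) Z
  rw [nl_self hg ks kv0] at h1
  have h5 : k (0, X) v (nl g k v Z) = 0 := by rw [ks]; exact kv0 _ _
  have h6 := ks (Z, 0) X v
  linarith

lemma chr_symm (hg : g.IsInvertible) (ks : ∀ ζ a b, k ζ a b = k ζ b a)
    (X Y : E) (kvs : ∀ a b c, k (0, a) b c = k (0, b) a c) :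
    chr g k v X Y = chr g k v Y X := by
  refine eq_of_g hg fun Z => ?_
  have h1 := g_chr (k := k) (v := v) hg X Y Z
  have h2 := g_chr (k := k) (v := v) hg Y X Z
  have h3 := ks (Z, 0) X Y
  have h4 := kvs X Y (nl g k v Z)
  linarith

lemma chr_compat (hg : g.IsInvertible) (hgs : ∀ a b, g a b = g b a)
    (ks : ∀ ζ a b, k ζ a b = k ζ b a)
    (kvs : ∀ a b c, k (0, a) b c = k (0, b) a c) (kv0 : ∀ a b, k (0, a) b v = 0) (X Y Z : E) : k (X, 0) Y Z = g (chr g k v X Y) Z + g Y (chr g k v X Z)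
    + k (0, chr g k v X v) Y Z := by
  rw [chr_v hg ks kv0, hgs Y]
  have h1 := g_chr (k := k) (v := v) hg X Y Z
  have h2 := g_chr (k := k) (v := v) hg X Z Y
  have a1 := ks (X, 0) Y Z
  have a2 := ks (Y, 0) X Z
  have a3 := ks (Z, 0) X Y
  have a4 := ks (0, nl g k v X) Y Z
  have a5 : k (0, X) Y (nl g k v Z) = k (0, nl g k v Z) X Y := by
    rw [ks, kvs]
  have a6 : k (0, X) Z (nl g k v Y) = k (0, nl g k v Y) X Z := by
    rw [ks, kvs]
  linarith

lemma chr_add_left (hg : g.IsInvertible)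
    (X X' Y : E) : chr g k v (X + X') Y = chr g k v X Y + chr g k v X' Y := by
  refine eq_of_g hg fun Z => ?_
  have hp (a b : E) : ((a + b, 0) : E × E) = (a, 0) + (b, 0) := by simp
  have hq (a b : E) : ((0, a + b) : E × E) = (0, a) + (0, b) := by simp
  have h1 := g_chr (k := k) (v := v) hg (X + X') Y Z
  have h2 := g_chr (k := k) (v := v) hg X Y Z
  have h3 := g_chr (k := k) (v := v) hg X' Y Z
  simp only [hp, hq, map_add, _root_.add_apply] at h1 ⊢
  linarith

lemma chr_smul_left (hg : g.IsInvertible)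
    (c : ℝ) (X Y : E) : chr g k v (c • X) Y = c • chr g k v X Y := by
  refine eq_of_g hg fun Z => ?_
  have hp (a : E) : ((c • a, 0) : E × E) = c • (a, 0) := by simp
  have hq (a : E) : ((0, c • a) : E × E) = c • (0, a) := by simp
  have h1 := g_chr (k := k) (v := v) hg (c • X) Y Z
  have h2 := g_chr (k := k) (v := v) hg X Y Z
  simp only [hp, hq, map_smul, _root_.smul_apply, smul_eq_mul] at h1 ⊢
  linear_combination (1 / 2) * h1 - c / 2 * h2
end Alg

section Smooth
variable [FiniteDimensional ℝ E] {P : Type*} [NormedAddCommGroup P] [NormedSpace ℝ P] {T : Set P}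
  {g : P → E →L[ℝ] E →L[ℝ] ℝ} {k : P → E × E →L[ℝ] E →L[ℝ] E →L[ℝ] ℝ} {v X Y : P → E}

lemma smooth_flip {F : Type*} [NormedAddCommGroup F] [NormedSpace ℝ F]
    {f : P → E →L[ℝ] E →L[ℝ] F} (hf : ContDiffOn ℝ ∞ f T) :
    ContDiffOn ℝ ∞ (fun p => (f p).flip) T := by
  rw [contDiffOn_clm_apply]; intro y
  rw [contDiffOn_clm_apply]; intro w
  exact (hf.clm_apply contDiffOn_const).clm_apply contDiffOn_const

lemma smooth_chr (hinv : ∀ p ∈ T, (g p).IsInvertible) (hg : ContDiffOn ℝ ∞ g T)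
    (hk : ContDiffOn ℝ ∞ k T) (hv : ContDiffOn ℝ ∞ v T) (hX : ContDiffOn ℝ ∞ X T)
    (hY : ContDiffOn ℝ ∞ Y T) :
    ContDiffOn ℝ ∞ (fun p => chr (g p) (k p) (v p) (X p) (Y p)) T := by
  have : CompleteSpace E := FiniteDimensional.complete ℝ E
  have hi : ContDiffOn ℝ ∞ (fun p => (g p).inverse) T := fun p hp =>
    (hinv p hp).contDiffAt_map_inverse.comp_contDiffWithinAt p (hg p hp)
  have hkx : ContDiffOn ℝ ∞ (fun p => kx (k p)) T := hk.clm_comp contDiffOn_const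
  have hkv : ContDiffOn ℝ ∞ (fun p => kv (k p)) T := hk.clm_comp contDiffOn_const
  have hf := smooth_flip hkx
  have hff := smooth_flip (hf.clm_apply hv)
  have hs : ContDiffOn ℝ ∞ (fun p => spr (g p) (k p) (v p)) T :=
    hi.clm_apply (((hkx.clm_apply hv).clm_apply hv).sub
      ((hff.clm_apply hv).const_smul (1 / 2 : ℝ)))
  have hn : ContDiffOn ℝ ∞ (fun p => nl (g p) (k p) (v p)) T :=
    hi.clm_comp (((((hf.clm_apply hv).add (hkx.clm_apply hv)).sub hff).sub
      (hkv.clm_apply hs)).const_smul (1 / 2 : ℝ))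
  have h1 := (smooth_flip (hf.clm_apply hX)).clm_apply hY
  exact hi.clm_apply ((((((((hkx.clm_apply hX).clm_apply hY).add ((hkx.clm_apply hY).clm_apply hX)).sub h1).sub
      ((hkv.clm_apply (hn.clm_apply hX)).clm_apply hY)).sub
      ((hkv.clm_apply (hn.clm_apply hY)).clm_apply hX)).add
      (((hkv.clm_apply hX).clm_apply hY).clm_comp hn)).const_smul (1 / 2 : ℝ))
end Smooth
end Local

/-! ### Auxiliary facts: vector fields in charts -/

section Mfd
set_option maxSynthPendingDepth 3
set_option linter.unusedSectionVars false
variable {E : Type*} [NormedAddCommGroup E] [NormedSpace ℝ E]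
  {M : Type*} [TopologicalSpace M] [ChartedSpace E M] [IsManifold 𝓘(ℝ, E) ∞ M]

/-- The components of a tangent vector at `q` in the chart around `p`. -/
noncomputable def components (p q : M) : TangentSpace 𝓘(ℝ, E) q →L[ℝ] E :=
  (trivializationAt E (TangentSpace 𝓘(ℝ, E)) p).continuousLinearMapAt ℝ q

/-- The vector field with constant components `w` in the chart around `p`. -/
noncomputable def coordinateField (p : M) (w : E) (q : M) : TangentSpace 𝓘(ℝ, E) q :=
  (trivializationAt E (TangentSpace 𝓘(ℝ, E)) p).symmL ℝ q w

lemma instB : ContMDiffVectorBundle ∞ E (TangentSpace 𝓘(ℝ, E) : M → Type _) 𝓘(ℝ, E) :=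
  haveI : IsManifold 𝓘(ℝ, E) (∞ + 1) M := inferInstanceAs (IsManifold 𝓘(ℝ, E) ∞ M)
  TangentBundle.contMDiffVectorBundle (n := ∞)

variable {p q : M}

lemma comp_coord (h : q ∈ (chartAt E p).source) (w : E) :
    components p q (coordinateField p w q) = w :=
  (trivializationAt E (TangentSpace 𝓘(ℝ, E)) p).continuousLinearMapAt_symmL (R := ℝ) h w

lemma coord_comp (h : q ∈ (chartAt E p).source) (y : TangentSpace 𝓘(ℝ, E) q) :
    coordinateField p (components p q y) q = y :=
  (trivializationAt E (TangentSpace 𝓘(ℝ, E)) p).symmL_continuousLinearMapAt (R := ℝ) h y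

lemma components_eq (h : q ∈ (chartAt E p).source) (y : TangentSpace 𝓘(ℝ, E) q) :
    (trivializationAt E (TangentSpace 𝓘(ℝ, E)) p ⟨q, y⟩).2 = components p q y := by
  rw [components, Trivialization.continuousLinearMapAt_apply,
    Trivialization.coe_linearMapAt_of_mem _ h]

lemma components_inj (h : q ∈ (chartAt E p).source) {y y' : TangentSpace 𝓘(ℝ, E) q}
    (e : components p q y = components p q y') : y = y' := by
  rw [← coord_comp h y, e, coord_comp h]

lemma coord_add (p q : M) (w w' : E) : coordinateField p (w + w') q =
    coordinateField p w q + coordinateField p w' q := by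
  simp only [coordinateField, map_add]

lemma coord_smul (p q : M) (c : ℝ) (w : E) : coordinateField p (c • w) q =
    c • coordinateField p w q := by
  simp only [coordinateField, map_smul]

/-- The point of the tangent bundle with given coordinates in the chart around `p`. -/
noncomputable def lift (p : M) (z : E × E) : TangentBundle 𝓘(ℝ, E) M :=
  ⟨(extChartAt 𝓘(ℝ, E) p).symm z.1, coordinateField p z.2 _⟩

lemma symm_source {x : E} (hx : x ∈ (extChartAt 𝓘(ℝ, E) p).target) :
    (extChartAt 𝓘(ℝ, E) p).symm x ∈ (chartAt E p).source := by
  rw [← extChartAt_source 𝓘(ℝ, E)]; exact (extChartAt 𝓘(ℝ, E) p).map_target hx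

lemma ext_mem (h : q ∈ (chartAt E p).source) :
    extChartAt 𝓘(ℝ, E) p q ∈ (extChartAt 𝓘(ℝ, E) p).target :=
  (extChartAt 𝓘(ℝ, E) p).map_source (by rwa [extChartAt_source])

lemma ext_inv (h : q ∈ (chartAt E p).source) :
    (extChartAt 𝓘(ℝ, E) p).symm (extChartAt 𝓘(ℝ, E) p q) = q :=
  (extChartAt 𝓘(ℝ, E) p).left_inv (by rwa [extChartAt_source])

lemma lift_ext (h : q ∈ (chartAt E p).source) (u : E) :
    lift p (extChartAt 𝓘(ℝ, E) p q, u) = ⟨q, coordinateField p u q⟩ := by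
  have : ∀ q', q' = q → (⟨q', coordinateField p u q'⟩ : TangentBundle 𝓘(ℝ, E) M) =
      ⟨q, coordinateField p u q⟩ := by rintro _ rfl; rfl
  exact this _ (ext_inv h)

lemma lift_comp (h : q ∈ (chartAt E p).source) (y : TangentSpace 𝓘(ℝ, E) q) :
    lift p (extChartAt 𝓘(ℝ, E) p q, components p q y) = ⟨q, y⟩ := by
  rw [lift_ext h, coord_comp h]

lemma isOpen_tgt (p : M) : IsOpen ((extChartAt 𝓘(ℝ, E) p).target ×ˢ (univ : Set E)) :=
  (isOpen_extChartAt_target p).prod isOpen_univ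

lemma lift_smooth (p : M) : ContMDiffOn 𝓘(ℝ, E × E) 𝓘(ℝ, E).tangent ∞ (lift p)
    ((extChartAt 𝓘(ℝ, E) p).target ×ˢ (univ : Set E)) := by
  have := instB (E := E) (M := M)
  rw [Trivialization.contMDiffOn_iff (e := trivializationAt E (TangentSpace 𝓘(ℝ, E)) p)]
  · constructor
    · exact (contMDiffOn_extChartAt_symm p).comp contDiff_fst.contMDiff.contMDiffOn
        fun z hz => hz.1
    · refine (contDiff_snd.contMDiff.contMDiffOn (s := _)).congr fun z hz => ?_
      exact (components_eq (symm_source hz.1) _).trans (comp_coord (symm_source hz.1) _)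
  · intro z hz
    exact symm_source hz.1

/-- A function on the tangent bundle in the chart around `p`. -/
noncomputable def locL (L : TangentBundle 𝓘(ℝ, E) M → ℝ) (p : M) (z : E × E) : ℝ := L (lift p z)

/-- The domain `A` in the chart around `p`. -/
def locS (A : Set (TangentBundle 𝓘(ℝ, E) M)) (p : M) : Set (E × E) :=
  ((extChartAt 𝓘(ℝ, E) p).target ×ˢ (univ : Set E)) ∩ lift p ⁻¹' A

/-- The coordinates of a point of the tangent bundle in the chart around `p`. -/
noncomputable def pt (p : M) (v : TangentBundle 𝓘(ℝ, E) M) : E × E :=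
  (extChartAt 𝓘(ℝ, E) p v.1, components p v.1 v.2)

variable {A : Set (TangentBundle 𝓘(ℝ, E) M)} {L : TangentBundle 𝓘(ℝ, E) M → ℝ}

lemma lift_pt {v : TangentBundle 𝓘(ℝ, E) M} (h : v.1 ∈ (chartAt E p).source) :
    lift p (pt p v) = v := lift_comp h v.2

lemma pt_mem {v : TangentBundle 𝓘(ℝ, E) M} (hv : v ∈ A) (h : v.1 ∈ (chartAt E p).source) :
    pt p v ∈ locS A p :=
  ⟨⟨ext_mem h, mem_univ _⟩, by rw [mem_preimage, lift_pt h]; exact hv⟩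

lemma locS_open (hA : IsOpen A) (p : M) : IsOpen (locS A p) :=
  (lift_smooth p).continuousOn.isOpen_inter_preimage (isOpen_tgt p) hA

lemma locL_smooth (hL : IsPseudoFinsler A L) (p : M) : ContDiffOn ℝ ∞ (locL L p) (locS A p) := by
  rw [← contMDiffOn_iff_contDiffOn]
  exact hL.smooth.comp ((lift_smooth p).mono inter_subset_left) fun z hz => hz.2

lemma locL_homog (hL : IsPseudoFinsler A L) (p : M) : ∀ z ∈ locS A p, ∀ c : ℝ, 0 < c →
    locL L p (z.1, c • z.2) = c ^ 2 * locL L p z := by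
  intro z hz c hc
  have := hL.homog _ hz.2 c hc
  rw [locL, locL, ← this]
  congr 1
  simp only [lift, coord_smul]
  rfl

lemma L_line {v : TangentBundle 𝓘(ℝ, E) M} (h : v.1 ∈ (chartAt E p).source)
    (y : TangentSpace 𝓘(ℝ, E) v.1) :
    L ⟨v.1, y⟩ = locL L p (extChartAt 𝓘(ℝ, E) p v.1, components p v.1 y) := by
  rw [locL, lift_comp h]

lemma fund_eq (hL : IsPseudoFinsler A L) {v : TangentBundle 𝓘(ℝ, E) M} (hv : v ∈ A)
    (h : v.1 ∈ (chartAt E p).source) (u w : TangentSpace 𝓘(ℝ, E) v.1) :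
    fundamentalTensor L v u w =
      locG (locL L p) (pt p v) (components p v.1 u) (components p v.1 w) := by
  rw [locG_apply, pt, ← deriv2 (locS_open hL.conic.isOpen p) (locL_smooth hL p) (pt_mem hv h)]
  simp only [fundamentalTensor, L_line h, map_add, map_smul]

lemma cartan_eq [FiniteDimensional ℝ E] (hL : IsPseudoFinsler A L)
    {v : TangentBundle 𝓘(ℝ, E) M} (hv : v ∈ A)
    (h : v.1 ∈ (chartAt E p).source) (a b c : TangentSpace 𝓘(ℝ, E) v.1) :
    2 * cartanTensor L v a b c = fderiv ℝ (locG (locL L p)) (pt p v) (0, components p v.1 a)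
      (components p v.1 b) (components p v.1 c) := by
  have hS := locS_open hL.conic.isOpen p
  have hl := locL_smooth hL p
  have hz := pt_mem hv h
  rw [locK_apply hS hl hz, loc3_symm12 hS hl hz, loc3_symm23 hS hl hz, loc3_symm12 hS hl hz, pt,
    ← deriv3 hS hl hz]
  simp only [cartanTensor, L_line h, map_add, map_smul]
  ring

section facts
variable [FiniteDimensional ℝ E]

lemma g_invertible (hL : IsPseudoFinsler A L) {z : E × E} (hz : z ∈ locS A p) :
    (locG (locL L p) z).IsInvertible := by
  refine nondeg_inv fun u hu => ?_
  have hs := symm_source hz.1.1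
  have e : pt p (lift p z) = z := by
    refine Prod.ext ((extChartAt 𝓘(ℝ, E) p).right_inv hz.1.1) (comp_coord hs _)
  have := hL.nondegenerate _ hz.2 (coordinateField p u _) fun w => by
    rw [fund_eq hL hz.2 hs, e]
    have e2 := comp_coord hs u
    erw [e2]
    exact hu _
  rw [← comp_coord hs u]
  exact (congrArg (components p _) this).trans (map_zero _)

lemma g_symm' (hL : IsPseudoFinsler A L) {z : E × E} (hz : z ∈ locS A p) (a b : E) :
    locG (locL L p) z a b = locG (locL L p) z b a := by
  rw [locG_apply, locG_apply, locH_symm (locS_open hL.conic.isOpen p) (locL_smooth hL p) hz]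

lemma k_symm (hL : IsPseudoFinsler A L) {z : E × E} (hz : z ∈ locS A p) (ζ : E × E) (a b : E) :
    fderiv ℝ (locG (locL L p)) z ζ a b = fderiv ℝ (locG (locL L p)) z ζ b a := by
  have hS := locS_open hL.conic.isOpen p
  have hl := locL_smooth hL p
  rw [locK_apply hS hl hz, locK_apply hS hl hz, loc3_symm23 hS hl hz]

lemma kv_symm (hL : IsPseudoFinsler A L) {z : E × E} (hz : z ∈ locS A p) (a b c : E) :
    fderiv ℝ (locG (locL L p)) z (0, a) b c = fderiv ℝ (locG (locL L p)) z (0, b) a c := by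
  have hS := locS_open hL.conic.isOpen p
  have hl := locL_smooth hL p
  rw [locK_apply hS hl hz, locK_apply hS hl hz, loc3_symm12 hS hl hz]

lemma kv_zero (hL : IsPseudoFinsler A L) {z : E × E} (hz : z ∈ locS A p) (a b : E) :
    fderiv ℝ (locG (locL L p)) z (0, a) b z.2 = 0 := by
  have hS := locS_open hL.conic.isOpen p
  have hl := locL_smooth hL p
  rw [locK_apply hS hl hz, euler3 hS hl (locL_homog hL p) hz, mul_zero]
end facts

/-- The components of a vector field in the chart around `p`, as a function on the model space. -/
noncomputable def locX (p : M) (X : ∀ q : M, TangentSpace 𝓘(ℝ, E) q) (x : E) : E :=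
  components p _ (X ((extChartAt 𝓘(ℝ, E) p).symm x))

lemma locX_ext (h : q ∈ (chartAt E p).source) (X : ∀ q : M, TangentSpace 𝓘(ℝ, E) q) :
    locX p X (extChartAt 𝓘(ℝ, E) p q) = components p q (X q) := by
  have : ∀ q', q' = q → components p q' (X q') = components p q (X q) := by rintro _ rfl; rfl
  exact this _ (ext_inv h)

lemma locX_smooth {Ω : Set M} {X : ∀ q : M, TangentSpace 𝓘(ℝ, E) q} (hX : IsVectorFieldOn Ω X)
    (p : M) : ContDiffOn ℝ ∞ (locX p X)
      ((extChartAt 𝓘(ℝ, E) p).target ∩ (extChartAt 𝓘(ℝ, E) p).symm ⁻¹' Ω) := by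
  have := instB (E := E) (M := M)
  have h1 : ContMDiffOn 𝓘(ℝ, E) 𝓘(ℝ, E) ∞ (fun q => components p q (X q))
      (Ω ∩ (chartAt E p).source) := by
    have := ((Trivialization.contMDiffOn_iff
      (e := trivializationAt E (TangentSpace 𝓘(ℝ, E)) p) fun q hq => hq.2).1
      (hX.smooth.mono inter_subset_left)).2
    exact this.congr fun q hq => (components_eq hq.2 _).symm
  rw [← contMDiffOn_iff_contDiffOn]
  exact h1.comp ((contMDiffOn_extChartAt_symm p).mono inter_subset_left)
    fun x hx => ⟨hx.2, symm_source hx.1⟩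

lemma loc_open {Ω : Set M} (hΩ : IsOpen Ω) (p : M) : IsOpen
    ((extChartAt 𝓘(ℝ, E) p).target ∩ (extChartAt 𝓘(ℝ, E) p).symm ⁻¹' Ω) :=
  (continuousOn_extChartAt_symm p).isOpen_inter_preimage (isOpen_extChartAt_target p) hΩ

lemma loc_mem {Ω : Set M} (hq : q ∈ Ω) (h : q ∈ (chartAt E p).source) :
    extChartAt 𝓘(ℝ, E) p q ∈ (extChartAt 𝓘(ℝ, E) p).target ∩
      (extChartAt 𝓘(ℝ, E) p).symm ⁻¹' Ω :=
  ⟨ext_mem h, by rw [mem_preimage, ext_inv h]; exact hq⟩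

lemma locX_diff {Ω : Set M} {X : ∀ q : M, TangentSpace 𝓘(ℝ, E) q} (hX : IsVectorFieldOn Ω X)
    (hq : q ∈ Ω) (h : q ∈ (chartAt E p).source) :
    DifferentiableAt ℝ (locX p X) (extChartAt 𝓘(ℝ, E) p q) :=
  ((locX_smooth hX p).differentiableOn (by simp)).differentiableAt
    ((loc_open hX.isOpen p).mem_nhds (loc_mem hq h))

lemma coord_field (p : M) (w : E) : IsVectorFieldOn (chartAt E p).source (coordinateField p w) := by
  have := instB (E := E) (M := M)
  refine ⟨(chartAt E p).open_source, ?_⟩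
  have hm : MapsTo (fun q => (⟨q, coordinateField p w q⟩ : TangentBundle 𝓘(ℝ, E) M))
      (chartAt E p).source (trivializationAt E (TangentSpace 𝓘(ℝ, E)) p).source := fun q hq => hq
  rw [Trivialization.contMDiffOn_iff (e := trivializationAt E (TangentSpace 𝓘(ℝ, E)) p) hm]
  refine ⟨contMDiffOn_id, (contMDiffOn_const (c := w)).congr fun q hq => ?_⟩
  exact (components_eq hq _).trans (comp_coord hq _)

lemma IsVectorFieldOn.mono {Ω Ω' : Set M} {X : ∀ q : M, TangentSpace 𝓘(ℝ, E) q}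
    (hX : IsVectorFieldOn Ω X) (h : Ω' ⊆ Ω) (ho : IsOpen Ω') : IsVectorFieldOn Ω' X :=
  ⟨ho, hX.smooth.mono h⟩

lemma mv_eq {f : M → ℝ} {F : E → ℝ} (h : q ∈ (chartAt E p).source)
    (hF : DifferentiableAt ℝ F (extChartAt 𝓘(ℝ, E) p q))
    (e : f =ᶠ[𝓝 q] fun q => F (extChartAt 𝓘(ℝ, E) p q)) (ξ : TangentSpace 𝓘(ℝ, E) q) :
    mvfderiv 𝓘(ℝ, E) f q ξ = fderiv ℝ F (extChartAt 𝓘(ℝ, E) p q) (components p q ξ) := by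
  have h1 : HasMFDerivAt 𝓘(ℝ, E) 𝓘(ℝ, E) (extChartAt 𝓘(ℝ, E) p) q (components p q) := by
    have := (mdifferentiableAt_extChartAt (I := 𝓘(ℝ, E)) h).hasMFDerivAt
    rwa [← TangentBundle.continuousLinearMapAt_trivializationAt h] at this
  have h2 := (hF.hasFDerivAt.hasMFDerivAt.comp q h1).congr_of_eventuallyEq e
  have h3 := h2.mfderiv
  rw [mvfderiv, h3]
  rfl

lemma bracket_eq [FiniteDimensional ℝ E] {Ω : Set M} {X Y : ∀ q : M, TangentSpace 𝓘(ℝ, E) q}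
    (hX : IsVectorFieldOn Ω X)
    (hY : IsVectorFieldOn Ω Y) (hq : q ∈ Ω) (h : q ∈ (chartAt E p).source) :
    VectorField.mlieBracket 𝓘(ℝ, E) X Y q = coordinateField p
      (fderiv ℝ (locX p Y) (extChartAt 𝓘(ℝ, E) p q) (components p q (X q)) -
       fderiv ℝ (locX p X) (extChartAt 𝓘(ℝ, E) p q) (components p q (Y q))) q := by
  have hm : IsManifold 𝓘(ℝ, E) (minSmoothness ℝ 2) M :=
    IsManifold.of_le (n := ∞) (by simpa using two_le_inf)
  have : CompleteSpace E := FiniteDimensional.complete ℝ E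
  have hd : ∀ q' ∈ (chartAt E p).source, ∀ y : TangentSpace 𝓘(ℝ, E) q',
      (mfderiv 𝓘(ℝ, E) 𝓘(ℝ, E) (extChartAt 𝓘(ℝ, E) p) q').inverse (components (E := E) p q' y) = y := by
    intro q' hq' y
    have e1 : components p q' = mfderiv 𝓘(ℝ, E) 𝓘(ℝ, E) (extChartAt 𝓘(ℝ, E) p) q' :=
      TangentBundle.continuousLinearMapAt_trivializationAt hq'
    obtain ⟨e, he⟩ := isInvertible_mfderiv_extChartAt (I := 𝓘(ℝ, E))
      (x := p) (y := q') (by rwa [extChartAt_source])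
    rw [e1, ← he]
    exact (congrArg (fun T => T (e y)) (ContinuousLinearMap.inverse_equiv e)).trans
      (e.symm_apply_apply y)
  have hp : ∀ X : (∀ q : M, TangentSpace 𝓘(ℝ, E) q), X =ᶠ[𝓝 q]
      VectorField.mpullback 𝓘(ℝ, E) 𝓘(ℝ, E) (extChartAt 𝓘(ℝ, E) p) (locX (E := E) p X) := by
    intro X
    filter_upwards [(chartAt E p).open_source.mem_nhds h] with q' hq'
    refine ((hd q' hq' (X q')).symm).trans ?_
    rw [← locX_ext hq']
    rfl
  have md : ∀ X : (∀ q : M, TangentSpace 𝓘(ℝ, E) q), IsVectorFieldOn Ω X →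
      MDifferentiableAt 𝓘(ℝ, E) 𝓘(ℝ, E).tangent
        (fun x => (⟨x, locX (E := E) p X x⟩ : TangentBundle 𝓘(ℝ, E) E)) (extChartAt 𝓘(ℝ, E) p q) := by
    intro X hX
    have := (locX_smooth hX p).contDiffAt ((loc_open hX.isOpen p).mem_nhds (loc_mem hq h))
    exact ((contMDiffAt_vectorSpace_iff_contDiffAt).2 this).mdifferentiableAt (by simp)
  rw [(hp X).mlieBracket_vectorField_eq (hp Y),
    ← VectorField.mpullback_mlieBracket (n := ∞) (md X hX) (md Y hY) (contMDiffAt_extChartAt' (I := 𝓘(ℝ, E)) h)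
      (by simpa using two_le_inf), VectorField.mpullback_apply]
  have gen : ∀ V W : (∀ x : E, TangentSpace 𝓘(ℝ, E) x),
      VectorField.mlieBracket 𝓘(ℝ, E) V W = VectorField.lieBracket ℝ V W := by
    intro V W
    rw [← VectorField.mlieBracketWithin_univ, VectorField.mlieBracketWithin_eq_lieBracketWithin]
    exact VectorField.lieBracketWithin_univ
  have e3 : VectorField.lieBracket ℝ (locX (E := E) p X) (locX p Y) (extChartAt 𝓘(ℝ, E) p q) =
      fderiv ℝ (locX p Y) (extChartAt 𝓘(ℝ, E) p q) (components p q (X q)) -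
       fderiv ℝ (locX p X) (extChartAt 𝓘(ℝ, E) p q) (components p q (Y q)) := by
    rw [VectorField.lieBracket, locX_ext h, locX_ext h]
  refine (congrArg _ ((congrFun (gen _ _) _).trans e3)).trans (Eq.trans ?_ (hd q h _))
  rw [comp_coord h]
end Mfd

/-! ### Existence and uniqueness of the Chern connection -/

section Existence
set_option maxSynthPendingDepth 3
set_option linter.unusedSectionVars false
variable {E : Type*} [NormedAddCommGroup E] [NormedSpace ℝ E]
  {M : Type*} [TopologicalSpace M] [ChartedSpace E M] [IsManifold 𝓘(ℝ, E) ∞ M]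
  {A : Set (TangentBundle 𝓘(ℝ, E) M)} {L : TangentBundle 𝓘(ℝ, E) M → ℝ} {p q : M}

/-- The components of `∇_X^v Y` in the chart around `p`. -/
noncomputable def locD (L : TangentBundle 𝓘(ℝ, E) M → ℝ) (p : M) (v : TangentBundle 𝓘(ℝ, E) M)
    (X Y : ∀ q : M, TangentSpace 𝓘(ℝ, E) q) : E :=
  fderiv ℝ (locX p Y) (extChartAt 𝓘(ℝ, E) p v.1) (components p v.1 (X v.1)) +
    chr (locG (locL L p) (pt p v)) (fderiv ℝ (locG (locL L p)) (pt p v)) (components p v.1 v.2)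
      (components p v.1 (X v.1)) (components p v.1 (Y v.1))

/-- The Chern connection as computed in the chart around `p`. -/
noncomputable def locNab (L : TangentBundle 𝓘(ℝ, E) M → ℝ) (p : M)
    (v : TangentBundle 𝓘(ℝ, E) M) (X Y : ∀ q : M, TangentSpace 𝓘(ℝ, E) q) :
    TangentSpace 𝓘(ℝ, E) v.1 :=
  coordinateField p (locD L p v X Y) v.1

lemma comp_locNab {v : TangentBundle 𝓘(ℝ, E) M} (h : v.1 ∈ (chartAt E p).source)
    (X Y : ∀ q : M, TangentSpace 𝓘(ℝ, E) q) :
    components p v.1 (locNab L p v X Y) = locD L p v X Y := comp_coord h _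

/-- The two properties of the Chern connection at one point. -/
structure ChernAt (L : TangentBundle 𝓘(ℝ, E) M → ℝ) (Ω : Set M)
    (V : ∀ q : M, TangentSpace 𝓘(ℝ, E) q) (q : M)
    (n : (∀ q : M, TangentSpace 𝓘(ℝ, E) q) → (∀ q : M, TangentSpace 𝓘(ℝ, E) q) →
      TangentSpace 𝓘(ℝ, E) q) : Prop where
  tor : ∀ X Y : (∀ q : M, TangentSpace 𝓘(ℝ, E) q), IsVectorFieldOn Ω X → IsVectorFieldOn Ω Y →
    n X Y - n Y X = VectorField.mlieBracket 𝓘(ℝ, E) X Y q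
  com : ∀ X Y Z : (∀ q : M, TangentSpace 𝓘(ℝ, E) q), IsVectorFieldOn Ω X → IsVectorFieldOn Ω Y →
    IsVectorFieldOn Ω Z →
    mvfderiv 𝓘(ℝ, E) (fun q => fundamentalTensor L ⟨q, V q⟩ (Y q) (Z q)) q (X q) =
        fundamentalTensor L ⟨q, V q⟩ (n X Y) (Z q) +
        fundamentalTensor L ⟨q, V q⟩ (Y q) (n X Z) +
        2 * cartanTensor L ⟨q, V q⟩ (n X V) (Y q) (Z q)

variable [FiniteDimensional ℝ E]

lemma chernAt_locNab (hL : IsPseudoFinsler A L) {Ω : Set M}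
    {V : ∀ q : M, TangentSpace 𝓘(ℝ, E) q} (hV : IsVectorFieldOn Ω V)
    (hVA : ∀ q ∈ Ω, (⟨q, V q⟩ : TangentBundle 𝓘(ℝ, E) M) ∈ A) (hq : q ∈ Ω)
    (h : q ∈ (chartAt E p).source) : ChernAt L Ω V q (locNab L p ⟨q, V q⟩) := by
  have hz : pt p (⟨q, V q⟩ : TangentBundle 𝓘(ℝ, E) M) ∈ locS A p := pt_mem (hVA q hq) h
  have hi := g_invertible hL hz
  have ks := k_symm hL hz
  have kvs := kv_symm hL hz
  have k0 := kv_zero hL hz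
  have gs := g_symm' hL hz
  constructor
  · intro X Y hX hY
    rw [bracket_eq hX hY hq h]
    apply components_inj h
    rw [map_sub, comp_coord h]
    have e1 := comp_locNab (L := L) (v := ⟨q, V q⟩) h X Y
    have e2 := comp_locNab (L := L) (v := ⟨q, V q⟩) h Y X
    have e3 := chr_symm hi ks (v := components p q (V q)) (components p q (X q))
      (components p q (Y q)) kvs
    simp only [locD] at e1 e2
    rw [e1, e2, e3]
    abel
  · intro X Y Z hX hY hZ
    have hS := locS_open hL.conic.isOpen p
    have hl := locL_smooth hL p
    have hvd := (locX_diff hV hq h).hasFDerivAt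
    have hyd := (locX_diff hY hq h).hasFDerivAt
    have hzd := (locX_diff hZ hq h).hasFDerivAt
    have ept : pt p (⟨q, V q⟩ : TangentBundle 𝓘(ℝ, E) M) =
      (extChartAt 𝓘(ℝ, E) p q, locX p V (extChartAt 𝓘(ℝ, E) p q)) := by
      rw [locX_ext h]; rfl
    have hgd : HasFDerivAt (locG (locL L p)) (fderiv ℝ (locG (locL L p))
        (pt p (⟨q, V q⟩ : TangentBundle 𝓘(ℝ, E) M)))
        (extChartAt 𝓘(ℝ, E) p q, locX p V (extChartAt 𝓘(ℝ, E) p q)) := by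
      rw [← ept]
      exact (diff_of hS (locG_smooth hS hl) hz).hasFDerivAt
    have hpr := (hasFDerivAt_id (𝕜 := ℝ) (extChartAt 𝓘(ℝ, E) p q)).prodMk hvd
    have hF := ((HasFDerivAt.comp (f := fun x => (id x, locX p V x))
      (extChartAt 𝓘(ℝ, E) p q) hgd hpr).clm_apply hyd).clm_apply hzd
    have ev : (fun q => fundamentalTensor L ⟨q, V q⟩ (Y q) (Z q)) =ᶠ[𝓝 q] fun q =>
        (fun x => locG (locL L p) (x, locX p V x) (locX p Y x) (locX p Z x))
          (extChartAt 𝓘(ℝ, E) p q) := by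
      filter_upwards [(chartAt E p).open_source.mem_nhds h, hV.isOpen.mem_nhds hq] with q' h1 h2
      simp only [locX_ext h1]
      exact fund_eq hL (hVA q' h2) h1 _ _
    rw [mv_eq h hF.differentiableAt ev]
    rw [hF.fderiv]
    have c1 := fund_eq hL (hVA q hq) h
    have c2 := cartan_eq hL (hVA q hq) h
    simp only [] at c1 c2
    rw [c1, c1, c2]
    have e1 := comp_locNab (L := L) (v := ⟨q, V q⟩) h X Y
    have e2 := comp_locNab (L := L) (v := ⟨q, V q⟩) h X Z
    have e3 := comp_locNab (L := L) (v := ⟨q, V q⟩) h X V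
    have key := chr_compat hi gs ks kvs k0 (components p q (X q)) (components p q (Y q))
      (components p q (Z q))
    simp only [locD] at e1 e2 e3
    rw [e1, e2, e3]
    set ξ := components p q (X q)
    have hp : ∀ w : E, ((ξ, w) : E × E) = (ξ, 0) + (0, w) := fun w => by simp
    have hp2 : ∀ w w' : E, ((0, w + w') : E × E) = (0, w) + (0, w') := fun w w' => by simp
    rw [hp2]
    simp only [_root_.add_apply, ContinuousLinearMap.comp_apply, ContinuousLinearMap.flip_apply,
      ContinuousLinearMap.prod_apply, ContinuousLinearMap.id_apply, locX_ext h, Function.comp_def,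
      id, map_add]
    have e4 : (extChartAt 𝓘(ℝ, E) p q, components p q (V q)) =
      pt p (⟨q, V q⟩ : TangentBundle 𝓘(ℝ, E) M) := rfl
    have e5 : (pt p (⟨q, V q⟩ : TangentBundle 𝓘(ℝ, E) M)).2 = components p q (V q) := rfl
    rw [e5] at key
    rw [hp, e4]
    simp only [_root_.add_apply, map_add]
    linarith

lemma chernAt_unique (hL : IsPseudoFinsler A L) {Ω : Set M}
    {V : ∀ q : M, TangentSpace 𝓘(ℝ, E) q} (hV : IsVectorFieldOn Ω V)
    (hVA : ∀ q ∈ Ω, (⟨q, V q⟩ : TangentBundle 𝓘(ℝ, E) M) ∈ A) (hq : q ∈ Ω)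
    (hΩ : Ω ⊆ (chartAt E p).source)
    {n n' : (∀ q : M, TangentSpace 𝓘(ℝ, E) q) → (∀ q : M, TangentSpace 𝓘(ℝ, E) q) →
      TangentSpace 𝓘(ℝ, E) q} (hn : ChernAt L Ω V q n) (hn' : ChernAt L Ω V q n')
    {X Y : ∀ q : M, TangentSpace 𝓘(ℝ, E) q} (hX : IsVectorFieldOn Ω X)
    (hY : IsVectorFieldOn Ω Y) : n X Y = n' X Y := by
  have h := hΩ hq
  have hz : pt p (⟨q, V q⟩ : TangentBundle 𝓘(ℝ, E) M) ∈ locS A p := pt_mem (hVA q hq) h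
  have hi := g_invertible hL hz
  have ks := k_symm hL hz
  have kvs := kv_symm hL hz
  have k0 : ∀ a b : E, fderiv ℝ (locG (locL L p)) (pt p (⟨q, V q⟩ : TangentBundle 𝓘(ℝ, E) M))
    (0, a) b (components p q (V q)) = 0 := kv_zero hL hz
  have gs := g_symm' hL hz
  set g := locG (locL L p) (pt p (⟨q, V q⟩ : TangentBundle 𝓘(ℝ, E) M)) with hg
  set k := fderiv ℝ (locG (locL L p)) (pt p (⟨q, V q⟩ : TangentBundle 𝓘(ℝ, E) M)) with hk
  let B : (∀ q : M, TangentSpace 𝓘(ℝ, E) q) → (∀ q : M, TangentSpace 𝓘(ℝ, E) q) → E :=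
    fun X Y => components p q (n X Y) - components p q (n' X Y)
  let c : (∀ q : M, TangentSpace 𝓘(ℝ, E) q) → E := fun X => components p q (X q)
  have bs : ∀ X Y, IsVectorFieldOn Ω X → IsVectorFieldOn Ω Y → B X Y = B Y X := by
    intro X Y hX hY
    have := congrArg (components (E := E) p q) ((hn.tor X Y hX hY).trans (hn'.tor X Y hX hY).symm)
    simp only [map_sub] at this
    simp only [B]
    rw [sub_eq_sub_iff_add_eq_add] at this ⊢
    rw [this, add_comm]
  have bc : ∀ X Y Z, IsVectorFieldOn Ω X → IsVectorFieldOn Ω Y → IsVectorFieldOn Ω Z →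
      g (B X Y) (c Z) + g (c Y) (B X Z) + k (0, B X V) (c Y) (c Z) = 0 := by
    intro X Y Z hX hY hZ
    have e := (hn.com X Y Z hX hY hZ).symm.trans (hn'.com X Y Z hX hY hZ)
    have c1 := fund_eq hL (hVA q hq) h
    have c2 := cartan_eq hL (hVA q hq) h
    simp only [] at c1 c2
    rw [c1, c1, c2, c1, c1, c2, ← hg, ← hk] at e
    have hp : ((0, B X V) : E × E) = (0, components p q (n X V)) - (0, components p q (n' X V)) := by
      simp [B]
    rw [hp]
    simp only [B, c, map_sub, _root_.sub_apply]
    linarith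
  have kos : ∀ X Y Z, IsVectorFieldOn Ω X → IsVectorFieldOn Ω Y → IsVectorFieldOn Ω Z →
      2 * g (B X Y) (c Z) + k (0, B X V) (c Y) (c Z) + k (0, B Y V) (c X) (c Z)
        - k (0, B Z V) (c X) (c Y) = 0 := by
    intro X Y Z hX hY hZ
    have h1 := bc X Y Z hX hY hZ
    have h2 := bc Y X Z hY hX hZ
    have h3 := bc Z X Y hZ hX hY
    rw [bs Y X hY hX, bs Y Z hY hZ] at h2
    rw [bs Z X hZ hX] at h3
    rw [gs (c Y)] at h1
    rw [gs (c X)] at h2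
    rw [gs (c X)] at h3
    linarith
  have ext : ∀ a : E, IsVectorFieldOn Ω (coordinateField p a : ∀ q : M, TangentSpace 𝓘(ℝ, E) q) ∧
      c (coordinateField p a) = a := fun a =>
    ⟨(coord_field p a).mono hΩ hX.isOpen, comp_coord h a⟩
  have z1 : B V V = 0 := by
    refine eq_of_g hi fun a => ?_
    obtain ⟨h1, h2⟩ := ext a
    have := kos V V _ hV hV h1
    rw [h2] at this
    have a1 := k0 (B V V) a
    rw [ks] at a1
    have a2 := k0 (B (coordinateField p a) V) (c V)
    simp only [c] at *
    simp only [map_zero, _root_.zero_apply]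
    linarith
  have z2 : ∀ X, IsVectorFieldOn Ω X → B X V = 0 := by
    intro X hX
    refine eq_of_g hi fun a => ?_
    obtain ⟨h1, h2⟩ := ext a
    have := kos X V _ hX hV h1
    rw [h2, z1] at this
    have a1 := k0 (B X V) a
    rw [ks] at a1
    have a2 := k0 (B (coordinateField p a) V) (c X)
    have a3 : ((0, 0) : E × E) = 0 := rfl
    rw [a3] at this
    simp only [c] at *
    simp only [map_zero, _root_.zero_apply] at *
    linarith
  have z3 : B X Y = 0 := by
    refine eq_of_g hi fun a => ?_
    obtain ⟨h1, h2⟩ := ext a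
    have := kos X Y _ hX hY h1
    rw [h2, z2 _ hX, z2 _ hY, z2 _ h1] at this
    have a3 : ((0, 0) : E × E) = 0 := rfl
    rw [a3] at this
    simp only [map_zero, _root_.zero_apply] at *
    linarith
  exact components_inj h (sub_eq_zero.1 z3)

lemma locNab_eq (hL : IsPseudoFinsler A L) {Ω : Set M} {X Y : ∀ q : M, TangentSpace 𝓘(ℝ, E) q}
    (hX : IsVectorFieldOn Ω X) (hY : IsVectorFieldOn Ω Y) {v : TangentBundle 𝓘(ℝ, E) M}
    (hv : v ∈ A) (hΩ : v.1 ∈ Ω) {p p' : M} (h : v.1 ∈ (chartAt E p).source)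
    (h' : v.1 ∈ (chartAt E p').source) : locNab L p v X Y = locNab L p' v X Y := by
  obtain ⟨q, y⟩ := v
  let V : ∀ q : M, TangentSpace 𝓘(ℝ, E) q := coordinateField p (components p q y)
  have hVq : V q = y := coord_comp h y
  have hV : IsVectorFieldOn (chartAt E p).source V := coord_field p _
  let Ω' : Set M := ((chartAt E p).source ∩
    (fun q => (⟨q, V q⟩ : TangentBundle 𝓘(ℝ, E) M)) ⁻¹' A) ∩ Ω
  have ho : IsOpen Ω' := (hV.smooth.continuousOn.isOpen_inter_preimage
    (chartAt E p).open_source hL.conic.isOpen).inter hX.isOpen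
  have hq : q ∈ Ω' := ⟨⟨h, by rw [mem_preimage, hVq]; exact hv⟩, hΩ⟩
  have hV' := hV.mono (Ω' := Ω') (fun x hx => hx.1.1) ho
  have hA : ∀ q ∈ Ω', (⟨q, V q⟩ : TangentBundle 𝓘(ℝ, E) M) ∈ A := fun x hx => hx.1.2
  have c1 := chernAt_locNab hL hV' hA hq h
  have c2 := chernAt_locNab hL hV' hA hq h'
  have := chernAt_unique hL hV' hA hq (p := p) (fun x hx => hx.1.1) c1 c2
    (hX.mono (fun x hx => hx.2) ho) (hY.mono (fun x hx => hx.2) ho)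
  rwa [hVq] at this

lemma chr_add_right {g : E →L[ℝ] E →L[ℝ] ℝ} {k : E × E →L[ℝ] E →L[ℝ] E →L[ℝ] ℝ} {v : E}
    (hg : g.IsInvertible) (X Y Y' : E) :
    chr g k v X (Y + Y') = chr g k v X Y + chr g k v X Y' := by
  refine eq_of_g hg fun Z => ?_
  have hp (a b : E) : ((a + b, 0) : E × E) = (a, 0) + (b, 0) := by simp
  have hq (a b : E) : ((0, a + b) : E × E) = (0, a) + (0, b) := by simp
  have h1 := g_chr (k := k) (v := v) hg X (Y + Y') Z
  have h2 := g_chr (k := k) (v := v) hg X Y Z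
  have h3 := g_chr (k := k) (v := v) hg X Y' Z
  simp only [hp, hq, map_add, _root_.add_apply] at h1 ⊢
  linarith

lemma chr_smul_right {g : E →L[ℝ] E →L[ℝ] ℝ} {k : E × E →L[ℝ] E →L[ℝ] E →L[ℝ] ℝ} {v : E}
    (hg : g.IsInvertible) (c : ℝ) (X Y : E) :
    chr g k v X (c • Y) = c • chr g k v X Y := by
  refine eq_of_g hg fun Z => ?_
  have hp (a : E) : ((c • a, 0) : E × E) = c • (a, 0) := by simp
  have hq (a : E) : ((0, c • a) : E × E) = c • (0, a) := by simp
  have h1 := g_chr (k := k) (v := v) hg X (c • Y) Z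
  have h2 := g_chr (k := k) (v := v) hg X Y Z
  simp only [hp, hq, map_smul, _root_.smul_apply, smul_eq_mul] at h1 ⊢
  linear_combination (1 / 2) * h1 - c / 2 * h2

/-- Existence of the Chern connection. -/
theorem exists_isChernConnection (hL : IsPseudoFinsler A L) :
    ∃ nab : AnisotropicConnection A, IsChernConnection L nab := by
  refine ⟨⟨fun v X Y => locNab L v.1 v X Y, ?_, ?_, ?_, ?_⟩, ?_⟩
  · intro Ω X Y Z hX hY hZ v hv hΩ
    have h := mem_chart_source E v.1
    apply components_inj h
    rw [map_add, comp_locNab h, comp_locNab h, comp_locNab h]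
    have hi := g_invertible hL (pt_mem hv h)
    have e : locX v.1 (fun q => Y q + Z q) = locX v.1 Y + locX v.1 Z := by
      ext x
      simp only [locX, map_add, Pi.add_apply]
    simp only [locD, e, map_add, chr_add_right hi]
    rw [fderiv_add (locX_diff hY hΩ h) (locX_diff hZ hΩ h), _root_.add_apply]
    abel
  · intro Ω f X Y hf hX hY v hv hΩ
    have h := mem_chart_source E v.1
    apply components_inj h
    rw [map_add, map_smul, map_smul, comp_locNab h, comp_locNab h]
    have hi := g_invertible hL (pt_mem hv h)
    set F : E → ℝ := fun x => f ((extChartAt 𝓘(ℝ, E) v.1).symm x) with hF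
    have hFd : DifferentiableAt ℝ F (extChartAt 𝓘(ℝ, E) v.1 v.1) := by
      have h1 : ContMDiffOn 𝓘(ℝ, E) 𝓘(ℝ, ℝ) ∞ F ((extChartAt 𝓘(ℝ, E) v.1).target ∩
          (extChartAt 𝓘(ℝ, E) v.1).symm ⁻¹' Ω) :=
        hf.comp ((contMDiffOn_extChartAt_symm v.1).mono inter_subset_left) fun x hx => hx.2
      exact (h1.contDiffOn.differentiableOn (by simp)).differentiableAt
        ((loc_open hX.isOpen v.1).mem_nhds (loc_mem hΩ h))
    have hFq : ∀ q ∈ (chartAt E v.1).source, F (extChartAt 𝓘(ℝ, E) v.1 q) = f q := fun q hq => by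
      rw [hF]; simp only [ext_inv hq]
    have ev : f =ᶠ[𝓝 v.1] fun q => F (extChartAt 𝓘(ℝ, E) v.1 q) := by
      filter_upwards [(chartAt E v.1).open_source.mem_nhds h] with q hq using (hFq q hq).symm
    rw [mv_eq h hFd ev]
    have e : locX v.1 (fun q => f q • Y q) = fun x => F x • locX v.1 Y x := by
      ext x
      simp only [locX, map_smul, hF]
    simp only [locD, e, map_smul, chr_smul_right hi]
    rw [(hFd.hasFDerivAt.fun_smul (locX_diff hY hΩ h).hasFDerivAt).fderiv, hFq _ h, locX_ext h]
    simp only [_root_.add_apply, _root_.smul_apply, ContinuousLinearMap.smulRight_apply, smul_add]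
    abel
  · intro Ω X Y hX hY v0 hv0
    refine (Bundle.contMDiffWithinAt_totalSpace).2 ⟨?_, ?_⟩
    · exact (contMDiff_proj (TangentSpace 𝓘(ℝ, E))).contMDiffAt.contMDiffWithinAt
    have hS := locS_open hL.conic.isOpen v0.1
    have hl := locL_smooth hL v0.1
    have h0 := mem_chart_source E v0.1
    set T : Set (E × E) := locS A v0.1 ∩ Prod.fst ⁻¹' ((extChartAt 𝓘(ℝ, E) v0.1).target ∩
      (extChartAt 𝓘(ℝ, E) v0.1).symm ⁻¹' Ω) with hT
    let R : E × E → E := fun z => fderiv ℝ (locX v0.1 Y) z.1 (locX v0.1 X z.1) +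
      chr (locG (locL L v0.1) z) (fderiv ℝ (locG (locL L v0.1)) z) z.2
        (locX v0.1 X z.1) (locX v0.1 Y z.1)
    have ho := loc_open (E := E) hX.isOpen v0.1
    have hR : ContDiffOn ℝ ∞ R T := by
      have hx : ContDiffOn ℝ ∞ (fun z : E × E => locX v0.1 X z.1) T :=
        (locX_smooth hX v0.1).comp contDiff_fst.contDiffOn fun z hz => hz.2
      have hy : ContDiffOn ℝ ∞ (fun z : E × E => locX v0.1 Y z.1) T :=
        (locX_smooth hY v0.1).comp contDiff_fst.contDiffOn fun z hz => hz.2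
      have hy' : ContDiffOn ℝ ∞ (fun z : E × E => fderiv ℝ (locX v0.1 Y) z.1) T :=
        ((locX_smooth hY v0.1).fderiv_of_isOpen (m := ∞) ho (by simp)).comp
          contDiff_fst.contDiffOn fun z hz => hz.2
      have hG := locG_smooth hS hl
      have hK : ContDiffOn ℝ ∞ (fderiv ℝ (locG (locL L v0.1))) (locS A v0.1) :=
        hG.fderiv_of_isOpen hS (by simp)
      exact (hy'.clm_apply hx).add (smooth_chr (fun z hz => g_invertible hL hz.1)
        (hG.mono inter_subset_left) (hK.mono inter_subset_left) contDiff_snd.contDiffOn hx hy)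
    have hTo : IsOpen T := hS.inter (ho.preimage continuous_fst)
    have hpt : ContMDiffAt 𝓘(ℝ, E).tangent 𝓘(ℝ, E × E) ∞ (pt v0.1) v0 := by
      have := instB (E := E) (M := M)
      have e2 := ((Bundle.contMDiffAt_totalSpace (IB := 𝓘(ℝ, E)) (F := E) (E := (TangentSpace 𝓘(ℝ, E) : M → Type _)) (n := ∞)
        (f := (id : TangentBundle 𝓘(ℝ, E) M → TangentBundle 𝓘(ℝ, E) M))
        (IM := 𝓘(ℝ, E).tangent) (x₀ := v0)).1 contMDiffAt_id).2
      have e1 : ContMDiffAt 𝓘(ℝ, E).tangent 𝓘(ℝ, E) ∞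
          (fun v : TangentBundle 𝓘(ℝ, E) M => extChartAt 𝓘(ℝ, E) v0.1 v.1) v0 :=
        ContMDiffAt.comp v0 (contMDiffAt_extChartAt' (I := 𝓘(ℝ, E)) (n := ∞) h0)
          (Bundle.contMDiff_proj (TangentSpace 𝓘(ℝ, E) : M → Type _)).contMDiffAt
      have := e1.prodMk_space e2
      refine this.congr_of_eventuallyEq ?_
      have hop : {v : TangentBundle 𝓘(ℝ, E) M | v.1 ∈ (chartAt E v0.1).source} ∈ 𝓝 v0 :=
        ((chartAt E v0.1).open_source.preimage
          (FiberBundle.continuous_proj E (TangentSpace 𝓘(ℝ, E)))).mem_nhds h0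
      filter_upwards [hop] with v hv
      exact Prod.ext rfl (components_eq hv v.2).symm
    have hmem : pt v0.1 v0 ∈ T := ⟨pt_mem hv0.1 h0, loc_mem hv0.2 h0⟩
    have hcomp : ContMDiffAt 𝓘(ℝ, E).tangent 𝓘(ℝ, E) ∞ (fun v => R (pt v0.1 v)) v0 :=
      ((hR.contDiffAt (hTo.mem_nhds hmem)).contMDiffAt).comp v0 hpt
    have key : ∀ v ∈ A, v.1 ∈ Ω → v.1 ∈ (chartAt E v0.1).source →
        (trivializationAt E (TangentSpace 𝓘(ℝ, E)) v0.1
          (⟨v.1, locNab L v.1 v X Y⟩ : TangentBundle 𝓘(ℝ, E) M)).2 = R (pt v0.1 v) := by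
      intro v hv hΩ hs
      rw [components_eq hs, locNab_eq hL hX hY hv hΩ (mem_chart_source E v.1) hs, comp_locNab hs]
      simp only [locD, R, pt, locX_ext hs]
    refine hcomp.contMDiffWithinAt.congr_of_eventuallyEq ?_ (key v0 hv0.1 hv0.2 h0)
    have hop : {v : TangentBundle 𝓘(ℝ, E) M | v.1 ∈ (chartAt E v0.1).source} ∈ 𝓝 v0 :=
      ((chartAt E v0.1).open_source.preimage
        (FiberBundle.continuous_proj E (TangentSpace 𝓘(ℝ, E)))).mem_nhds h0
    filter_upwards [self_mem_nhdsWithin, mem_nhdsWithin_of_mem_nhds hop] with v hv hs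
    exact key v hv.1 hv.2 hs
  · intro Ω f k X Y Z hf hk hX hY hZ v hv hΩ
    have h := mem_chart_source E v.1
    apply components_inj h
    rw [map_add, map_smul, map_smul, comp_locNab h, comp_locNab h, comp_locNab h]
    have hi := g_invertible hL (pt_mem hv h)
    simp only [locD, map_add, map_smul, chr_add_left hi, chr_smul_left hi, smul_add]
    abel
  · constructor
    · intro Ω V X Y hV hVA hX hY q hq
      exact (chernAt_locNab hL hV hVA hq (mem_chart_source E q)).tor X Y hX hY
    · intro Ω V X Y Z hV hVA hX hY hZ q hq
      exact (chernAt_locNab hL hV hVA hq (mem_chart_source E q)).com X Y Z hX hY hZ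
/-- Uniqueness of the Chern connection. -/
theorem IsChernConnection.unique (hL : IsPseudoFinsler A L) {nab nab' : AnisotropicConnection A}
    (hn : IsChernConnection L nab) (hn' : IsChernConnection L nab') {Ω : Set M}
    {X Y : ∀ q : M, TangentSpace 𝓘(ℝ, E) q} (hX : IsVectorFieldOn Ω X)
    (hY : IsVectorFieldOn Ω Y) {v : TangentBundle 𝓘(ℝ, E) M} (hv : v ∈ A) (hΩ : v.1 ∈ Ω) :
    nab.toFun v X Y = nab'.toFun v X Y := by
  obtain ⟨p, y⟩ := v
  have h := mem_chart_source E p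
  let V : ∀ q : M, TangentSpace 𝓘(ℝ, E) q := coordinateField p (components p p y)
  have hVq : V p = y := coord_comp h y
  have hV : IsVectorFieldOn (chartAt E p).source V := coord_field p _
  let Ω' : Set M := ((chartAt E p).source ∩
    (fun q => (⟨q, V q⟩ : TangentBundle 𝓘(ℝ, E) M)) ⁻¹' A) ∩ Ω
  have ho : IsOpen Ω' := (hV.smooth.continuousOn.isOpen_inter_preimage
    (chartAt E p).open_source hL.conic.isOpen).inter hX.isOpen
  have hq : p ∈ Ω' := ⟨⟨h, by rw [mem_preimage, hVq]; exact hv⟩, hΩ⟩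
  have hV' := hV.mono (Ω' := Ω') (fun x hx => hx.1.1) ho
  have hA : ∀ q ∈ Ω', (⟨q, V q⟩ : TangentBundle 𝓘(ℝ, E) M) ∈ A := fun x hx => hx.1.2
  have c1 : ChernAt L Ω' V p (nab.toFun ⟨p, V p⟩) :=
    ⟨fun X Y hX hY => hn.torsionFree Ω' V X Y hV' hA hX hY p hq,
      fun X Y Z hX hY hZ => hn.almostCompatible Ω' V X Y Z hV' hA hX hY hZ p hq⟩
  have c2 : ChernAt L Ω' V p (nab'.toFun ⟨p, V p⟩) :=
    ⟨fun X Y hX hY => hn'.torsionFree Ω' V X Y hV' hA hX hY p hq,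
      fun X Y Z hX hY hZ => hn'.almostCompatible Ω' V X Y Z hV' hA hX hY hZ p hq⟩
  have := chernAt_unique hL hV' hA hq (p := p) (fun x hx => hx.1.1) c1 c2
    (hX.mono (fun x hx => hx.2) ho) (hY.mono (fun x hx => hx.2) ho)
  rwa [hVq] at this

end Existence

/-! ### The Chern connection, covariant derivatives along curves and geodesics -/

section Curves
variable {E : Type*} [NormedAddCommGroup E] [NormedSpace ℝ E]
  {M : Type*} [TopologicalSpace M] [ChartedSpace E M] [IsManifold 𝓘(ℝ, E) ∞ M]
  {A : Set (TangentBundle 𝓘(ℝ, E) M)}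

/-- The Chern connection of a pseudo-Finsler metric: the anisotropic connection which is torsion
free and almost `g`-compatible. It exists by `exists_isChernConnection` and its values on smooth
fields at vectors of `A` are unique by `IsChernConnection.unique`. -/
noncomputable def chernConnection [FiniteDimensional ℝ E] {L : TangentBundle 𝓘(ℝ, E) M → ℝ}
    (hL : IsPseudoFinsler A L) : AnisotropicConnection A :=
  Classical.choose (exists_isChernConnection hL)

theorem chernConnection_spec [FiniteDimensional ℝ E] {L : TangentBundle 𝓘(ℝ, E) M → ℝ}
    (hL : IsPseudoFinsler A L) : IsChernConnection L (chernConnection hL) :=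
  Classical.choose_spec (exists_isChernConnection hL)

/-- The velocity of a curve `γ : [a, b] → M` (one-sided at the endpoints). -/
noncomputable def velocity (a b : ℝ) (γ : ℝ → M) (t : ℝ) : TangentSpace 𝓘(ℝ, E) (γ t) :=
  mfderivWithin 𝓘(ℝ, ℝ) 𝓘(ℝ, E) γ (Icc a b) t (1 : ℝ)

/-- The velocity of a curve `γ : [a, b] → M` as a point of the tangent bundle. -/
noncomputable def velocityLift (a b : ℝ) (γ : ℝ → M) (t : ℝ) : TangentBundle 𝓘(ℝ, E) M :=
  ⟨γ t, velocity a b γ t⟩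

/-- The covariant derivative `D_γ^U X` at time `t` of a vector field `X` along `γ : [a, b] → M`
with reference field `U`, induced by an anisotropic connection. In the chart around `γ t` it is
`(Ẋ^k + γ̇^i X^j Γ_ij^k(U)) ∂_k`, where `Γ_ij^k(U) ∂_k = ∇_{∂_i}^U ∂_j`; the second summand is the
derivative of the field with the constant components of `X t` in the direction of `γ̇ t`. -/
noncomputable def covariantDerivative (nab : AnisotropicConnection A) (a b : ℝ) (γ : ℝ → M)
    (U X : ∀ t : ℝ, TangentSpace 𝓘(ℝ, E) (γ t)) (t : ℝ) : TangentSpace 𝓘(ℝ, E) (γ t) :=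
  coordinateField (γ t)
      (derivWithin (fun τ => components (E := E) (γ t) (γ τ) (X τ)) (Icc a b) t) (γ t) +
    nab.toFun ⟨γ t, U t⟩
      (coordinateField (γ t) (components (γ t) (γ t) (velocity a b γ t)))
      (coordinateField (γ t) (components (γ t) (γ t) (X t)))

/-- `γ` is a smooth `A`-admissible curve on `[a, b]`. -/
structure IsAdmissibleCurve (A : Set (TangentBundle 𝓘(ℝ, E) M)) (a b : ℝ) (γ : ℝ → M) : Prop where
  smooth : ContMDiffOn 𝓘(ℝ, ℝ) 𝓘(ℝ, E) ∞ γ (Icc a b)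
  velocity_mem : ∀ t ∈ Icc a b, velocityLift a b γ t ∈ A

/-- `γ` is a smooth (`A`-admissible) lightlike curve of `L` on `[a, b]`. -/
structure IsLightlikeCurve (A : Set (TangentBundle 𝓘(ℝ, E) M))
    (L : TangentBundle 𝓘(ℝ, E) M → ℝ) (a b : ℝ) (γ : ℝ → M) : Prop where
  admissible : IsAdmissibleCurve A a b γ
  lightlike : ∀ t ∈ Icc a b, L (velocityLift a b γ t) = 0

/-- `γ` is a geodesic of the pseudo-Finsler metric `L` on `[a, b]`: a smooth `A`-admissible curve
with `D_γ^{γ̇} γ̇ = 0`, for the Chern connection of `L`. -/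
structure IsGeodesic [FiniteDimensional ℝ E] {L : TangentBundle 𝓘(ℝ, E) M → ℝ}
    (hL : IsPseudoFinsler A L) (a b : ℝ) (γ : ℝ → M) : Prop where
  admissible : IsAdmissibleCurve A a b γ
  geodesic : ∀ t ∈ Icc a b,
    covariantDerivative (chernConnection hL) a b γ (velocity a b γ) (velocity a b γ) t = 0
end Curves

end PseudoFinsler

/-!
The proof compares Euler–Lagrange equations. In a chart write `z = (x, v)` for the velocity of `γ`
and `EL_l(Z) = d/dt l_v(Z) - l_x(Z)` for the Euler–Lagrange expression along `z` (`eulerLagrange`).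

* For a two-homogeneous `l` with fundamental tensor `g`, Euler's relations give
  `2 g(v, Z) = l_v(Z)` (`locG_apply_self`) and `2 g(v̇ + spr, Z) = EL_l(Z)` (`locG_add_spr`), where
  `spr` is the spray.
* The Chern symbols contracted twice with the velocity are the spray, so that
  `D_γ^γ̇ (f γ̇) = f' γ̇ + f (v̇ + spr)`
  (`components_covariantDerivative_smul_velocity`); `f = 1` gives the geodesic operator.
* If `l` vanishes along `γ`, so does its derivative along `γ`, and the product rule leaves
  `EL_{m l} = m EL_l + m' l_v` (`eulerLagrange_mul`).

Together, with `m = λ`, and `g̃` and `D̃` belonging to `λ L`,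
`g̃(D̃_γ^γ̇ γ̇, Z) = g(λ (v̇ + spr) + λ' v, Z) = g(D_γ^γ̇ (λ γ̇), Z)` along a lightlike curve.
Since `g` and `g̃` are nondegenerate, one side vanishes for every `Z` exactly when the other does.
The lightlike curves of `L` and `λ L` coincide because `λ > 0`.
-/

namespace PseudoFinsler

/-! ### The spray as an Euler–Lagrange operator -/

section EulerLagrange
set_option maxSynthPendingDepth 3

variable {E : Type*} [NormedAddCommGroup E] [NormedSpace ℝ E]

/-- The Euler–Lagrange expression of a Lagrangian `l` in coordinates: for a curve `z = (x, v)` in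
`E × E` with derivative `ζ`, its value on `Z` is `d/dt (∂l/∂v) Z - (∂l/∂x) Z`. -/
noncomputable def eulerLagrange (l : E × E → ℝ) (z ζ : E × E) (Z : E) : ℝ :=
  fderiv ℝ (fderiv ℝ l) z ζ (0, Z) - fderiv ℝ l z (Z, 0)

variable {l m : E × E → ℝ} {S : Set (E × E)} {z : E × E}

/-- Euler's relation for the vertical derivative of `l`, differentiated along the base. -/
lemma fderiv3_apply_vertical (hS : IsOpen S) (hl : ContDiffOn ℝ ∞ l S)
    (hh : ∀ z ∈ S, ∀ c : ℝ, 0 < c → l (z.1, c • z.2) = c ^ 2 * l z) (hz : z ∈ S)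
    (a y : E) :
    fderiv ℝ (fderiv ℝ (fderiv ℝ l)) z (a, 0) (0, y) (0, z.2) =
      fderiv ℝ (fderiv ℝ l) z (a, 0) (0, y) := by
  have hd : HasFDerivAt (fun z : E × E => ((0, z.2) : E × E))
      ((ContinuousLinearMap.inr ℝ E E).comp (ContinuousLinearMap.snd ℝ E E)) z :=
    ((ContinuousLinearMap.inr ℝ E E).comp (ContinuousLinearMap.snd ℝ E E)).hasFDerivAt
  have h1 := ((diff_of hS (cd2 hS hl) hz).hasFDerivAt.clm_apply
    (hasFDerivAt_const ((0, y) : E × E) z)).clm_apply hd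
  have h2 := (diff_of hS (cd1 hS hl) hz).hasFDerivAt.clm_apply
    (hasFDerivAt_const ((0, y) : E × E) z)
  have e : (fun z : E × E => fderiv ℝ (fderiv ℝ l) z (0, y) (0, z.2)) =ᶠ[𝓝 z]
      fun z => fderiv ℝ l z (0, y) := by
    filter_upwards [hS.mem_nhds hz] with w hw using euler2 hS hl hh hw _
  have := DFunLike.congr_fun (h1.unique (h2.congr_of_eventuallyEq e)) (a, 0)
  have h0 : ((0, 0) : E × E) = 0 := rfl
  simpa [h0] using this

/-- Euler's relation `l_v v = 2 l`, differentiated along the base. -/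
lemma fderiv2_apply_vertical (hS : IsOpen S) (hl : ContDiffOn ℝ ∞ l S)
    (hh : ∀ z ∈ S, ∀ c : ℝ, 0 < c → l (z.1, c • z.2) = c ^ 2 * l z) (hz : z ∈ S) (a : E) :
    fderiv ℝ (fderiv ℝ l) z (a, 0) (0, z.2) = 2 * fderiv ℝ l z (a, 0) := by
  have hd : HasFDerivAt (fun z : E × E => ((0, z.2) : E × E))
      ((ContinuousLinearMap.inr ℝ E E).comp (ContinuousLinearMap.snd ℝ E E)) z :=
    ((ContinuousLinearMap.inr ℝ E E).comp (ContinuousLinearMap.snd ℝ E E)).hasFDerivAt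
  have h1 := (diff_of hS (cd1 hS hl) hz).hasFDerivAt.clm_apply hd
  have h2 := (diff_of hS hl hz).hasFDerivAt.const_mul (2 : ℝ)
  have e : (fun z : E × E => fderiv ℝ l z (0, z.2)) =ᶠ[𝓝 z] fun z => 2 * l z := by
    filter_upwards [hS.mem_nhds hz] with w hw using euler1 hS hl hh hw
  have := DFunLike.congr_fun (h1.unique (h2.congr_of_eventuallyEq e)) (a, 0)
  have h0 : ((0, 0) : E × E) = 0 := rfl
  simpa [h0] using this

/-- Lowering the index of the velocity gives half the vertical derivative of the Lagrangian. -/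
lemma locG_apply_self (hS : IsOpen S) (hl : ContDiffOn ℝ ∞ l S)
    (hh : ∀ z ∈ S, ∀ c : ℝ, 0 < c → l (z.1, c • z.2) = c ^ 2 * l z) (hz : z ∈ S) (Z : E) :
    2 * locG l z z.2 Z = fderiv ℝ l z (0, Z) := by
  rw [locG_apply, locH_symm hS hl hz, euler2 hS hl hh hz]
  ring

/-- Lowering the index of the acceleration `v̇ + spr` gives half the Euler–Lagrange expression. -/
lemma locG_add_spr [FiniteDimensional ℝ E] (hS : IsOpen S) (hl : ContDiffOn ℝ ∞ l S)
    (hh : ∀ z ∈ S, ∀ c : ℝ, 0 < c → l (z.1, c • z.2) = c ^ 2 * l z) (hz : z ∈ S)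
    (hi : (locG l z).IsInvertible) (w Z : E) :
    2 * locG l z (w + spr (locG l z) (fderiv ℝ (locG l) z) z.2) Z =
      eulerLagrange l z (z.2, w) Z := by
  have h1 : fderiv ℝ (locG l) z (z.2, 0) z.2 Z =
      1 / 2 * fderiv ℝ (fderiv ℝ l) z (z.2, 0) (0, Z) := by
    rw [locK_apply hS hl hz, loc3_symm23 hS hl hz, fderiv3_apply_vertical hS hl hh hz]
  have h2 : fderiv ℝ (locG l) z (Z, 0) z.2 z.2 = fderiv ℝ l z (Z, 0) := by
    rw [locK_apply hS hl hz, fderiv3_apply_vertical hS hl hh hz,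
      fderiv2_apply_vertical hS hl hh hz]
    ring
  have h3 : ((z.2, w) : E × E) = (z.2, 0) + (0, w) := by simp
  rw [map_add, _root_.add_apply, g_spr hi, h1, h2, locG_apply, eulerLagrange, h3, map_add,
    _root_.add_apply]
  ring

/-- Where `l` vanishes to first order along `ζ`, the Euler–Lagrange expression of `m * l` involves
only the first derivative of the factor `m` along `ζ`. -/
lemma eulerLagrange_mul (hS : IsOpen S) (hm : ContDiffOn ℝ ∞ m S) (hl : ContDiffOn ℝ ∞ l S)
    (hz : z ∈ S) {ζ : E × E} (h0 : l z = 0) (h1 : fderiv ℝ l z ζ = 0) (Z : E) :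
    eulerLagrange (fun z => m z * l z) z ζ Z =
      m z * eulerLagrange l z ζ Z + fderiv ℝ m z ζ * fderiv ℝ l z (0, Z) := by
  have e1 : ∀ y ∈ S, fderiv ℝ (fun z => m z * l z) y = m y • fderiv ℝ l y + l y • fderiv ℝ m y :=
    fun y hy => fderiv_fun_mul (diff_of hS hm hy) (diff_of hS hl hy)
  have e2 : fderiv ℝ (fderiv ℝ (fun z => m z * l z)) z ζ (0, Z) =
      m z * fderiv ℝ (fderiv ℝ l) z ζ (0, Z) + fderiv ℝ m z ζ * fderiv ℝ l z (0, Z) := by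
    have ev : fderiv ℝ (fun z => m z * l z) =ᶠ[𝓝 z]
        fun y => m y • fderiv ℝ l y + l y • fderiv ℝ m y := by
      filter_upwards [hS.mem_nhds hz] with y hy using e1 y hy
    have hd := ((diff_of hS hm hz).hasFDerivAt.fun_smul
      (diff_of hS (cd1 hS hl) hz).hasFDerivAt).fun_add
      ((diff_of hS hl hz).hasFDerivAt.fun_smul (diff_of hS (cd1 hS hm) hz).hasFDerivAt)
    rw [ev.fderiv_eq, hd.fderiv]
    simp [h0, h1]
  rw [eulerLagrange, eulerLagrange, e2, e1 z hz]
  simp [h0]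
  ring

end EulerLagrange

/-! ### Covariant derivatives along curves in a chart -/

section Chart
set_option maxSynthPendingDepth 3

variable {E : Type*} [NormedAddCommGroup E] [NormedSpace ℝ E]
  {M : Type*} [TopologicalSpace M] [ChartedSpace E M] [IsManifold 𝓘(ℝ, E) ∞ M]
  {A : Set (TangentBundle 𝓘(ℝ, E) M)} {L : TangentBundle 𝓘(ℝ, E) M → ℝ}
  {a b t : ℝ} {γ : ℝ → M} {p : M}

lemma locL_contDiffOn (hL : ContMDiffOn 𝓘(ℝ, E).tangent 𝓘(ℝ, ℝ) ∞ L A) (p : M) :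
    ContDiffOn ℝ ∞ (locL L p) (locS A p) := by
  rw [← contMDiffOn_iff_contDiffOn]
  exact hL.comp ((lift_smooth p).mono inter_subset_left) fun z hz => hz.2

/-- The components of the velocity are the derivative of the curve in the chart. -/
lemma components_velocity (hγ : ContMDiffOn 𝓘(ℝ, ℝ) 𝓘(ℝ, E) ∞ γ (Icc a b))
    (ht : t ∈ Icc a b) (h : γ t ∈ (chartAt E p).source) :
    HasDerivWithinAt (fun τ => extChartAt 𝓘(ℝ, E) p (γ τ))
      (components p (γ t) (velocity a b γ t)) (Icc a b) t := by
  have h1 : HasMFDerivAt 𝓘(ℝ, E) 𝓘(ℝ, E) (extChartAt 𝓘(ℝ, E) p) (γ t)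
      (components p (γ t)) := by
    have := (mdifferentiableAt_extChartAt (I := 𝓘(ℝ, E)) h).hasMFDerivAt
    rwa [← TangentBundle.continuousLinearMapAt_trivializationAt h] at this
  have h2 := ((hγ t ht).mdifferentiableWithinAt (by simp)).hasMFDerivWithinAt
  have h3 : HasFDerivWithinAt (fun τ => extChartAt 𝓘(ℝ, E) p (γ τ))
      ((components p (γ t)).comp (mfderivWithin 𝓘(ℝ, ℝ) 𝓘(ℝ, E) γ (Icc a b) t) : ℝ →L[ℝ] E)
      (Icc a b) t := (h1.comp_hasMFDerivWithinAt t h2).hasFDerivWithinAt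
  exact h3.hasDerivWithinAt

omit [IsManifold 𝓘(ℝ, E) ∞ M] in
lemma eventually_mem_chart (hγ : ContMDiffOn 𝓘(ℝ, ℝ) 𝓘(ℝ, E) ∞ γ (Icc a b))
    (ht : t ∈ Icc a b) (h : γ t ∈ (chartAt E p).source) :
    ∀ᶠ τ in 𝓝[Icc a b] t, γ τ ∈ (chartAt E p).source :=
  (hγ.continuousOn t ht).eventually_mem ((chartAt E p).open_source.mem_nhds h)

/-- The components of the velocity form a differentiable curve, up to the endpoints. -/
lemma differentiableWithinAt_components_velocity
    (hγ : ContMDiffOn 𝓘(ℝ, ℝ) 𝓘(ℝ, E) ∞ γ (Icc a b)) (hab : a < b)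
    (ht : t ∈ Icc a b) (h : γ t ∈ (chartAt E p).source) :
    DifferentiableWithinAt ℝ (fun τ => components (E := E) p (γ τ) (velocity a b γ τ)) (Icc a b) t := by
  have hx : ContDiffWithinAt ℝ ∞ (fun τ => extChartAt 𝓘(ℝ, E) p (γ τ)) (Icc a b) t := by
    have := (contMDiffAt_extChartAt' (I := 𝓘(ℝ, E)) (n := ∞) h).comp_contMDiffWithinAt t (hγ t ht)
    exact this.contDiffWithinAt
  have hd : ContDiffWithinAt ℝ 1
      (derivWithin (fun τ => extChartAt 𝓘(ℝ, E) p (γ τ)) (Icc a b)) (Icc a b) t := by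
    have := hx.fderivWithin_right (m := 1) (uniqueDiffOn_Icc hab) (by exact two_le_inf) ht
    exact this.clm_apply contDiffWithinAt_const
  have ev : (fun τ => components (E := E) p (γ τ) (velocity a b γ τ)) =ᶠ[𝓝[Icc a b] t]
      derivWithin (fun τ => extChartAt 𝓘(ℝ, E) p (γ τ)) (Icc a b) := by
    filter_upwards [eventually_mem_chart hγ ht h, self_mem_nhdsWithin] with τ h1 h2
    exact ((components_velocity hγ h2 h1).derivWithin (uniqueDiffOn_Icc hab τ h2)).symm
  exact (hd.differentiableWithinAt (by simp)).congr_of_eventuallyEq ev (ev.self_of_nhdsWithin ht)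

/-- A function on the tangent bundle, evaluated along the velocity of a curve, differentiated in
a chart. -/
lemma hasDerivWithinAt_velocityLift (hA : IsOpen A)
    (hL : ContMDiffOn 𝓘(ℝ, E).tangent 𝓘(ℝ, ℝ) ∞ L A) (hγ : IsAdmissibleCurve A a b γ)
    (hab : a < b) (ht : t ∈ Icc a b) (h : γ t ∈ (chartAt E p).source) :
    HasDerivWithinAt (fun τ => L (velocityLift a b γ τ))
      (fderiv ℝ (locL L p) (pt p (velocityLift a b γ t))
        (components p (γ t) (velocity a b γ t),
          derivWithin (fun τ => components (E := E) p (γ τ) (velocity a b γ τ)) (Icc a b) t))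
      (Icc a b) t := by
  have hz := pt_mem (p := p) (hγ.velocity_mem t ht) h
  have hd := (diff_of (locS_open hA p) (locL_contDiffOn hL p) hz).hasFDerivAt
  have hc := (components_velocity hγ.smooth ht h).prodMk
    (differentiableWithinAt_components_velocity hγ.smooth hab ht h).hasDerivWithinAt
  have hcomp := HasFDerivAt.comp_hasDerivWithinAt
    (f := fun τ => (extChartAt 𝓘(ℝ, E) p (γ τ), components (E := E) p (γ τ) (velocity a b γ τ))) t hd hc
  have ev : (fun τ => L (velocityLift a b γ τ)) =ᶠ[𝓝[Icc a b] t] (locL L p ∘ fun τ =>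
      (extChartAt 𝓘(ℝ, E) p (γ τ), components (E := E) p (γ τ) (velocity a b γ τ))) := by
    filter_upwards [eventually_mem_chart hγ.smooth ht h] with τ hτ
    exact L_line (L := L) (v := velocityLift a b γ τ) hτ _
  exact hcomp.congr_of_eventuallyEq ev (ev.self_of_nhdsWithin ht)

variable [FiniteDimensional ℝ E]

/-- The Chern connection agrees, near the base point, with its expression in a chart. -/
lemma IsChernConnection.eq_locNab (hL : IsPseudoFinsler A L) {nab : AnisotropicConnection A}
    (hn : IsChernConnection L nab) {Ω : Set M} {X Y : ∀ q : M, TangentSpace 𝓘(ℝ, E) q}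
    (hX : IsVectorFieldOn Ω X) (hY : IsVectorFieldOn Ω Y) {v : TangentBundle 𝓘(ℝ, E) M}
    (hv : v ∈ A) (hΩ : v.1 ∈ Ω) (h : v.1 ∈ (chartAt E p).source) :
    nab.toFun v X Y = locNab L p v X Y := by
  obtain ⟨q, y⟩ := v
  let V : ∀ q : M, TangentSpace 𝓘(ℝ, E) q := coordinateField p (components p q y)
  have hVq : V q = y := coord_comp h y
  have hV : IsVectorFieldOn (chartAt E p).source V := coord_field p _
  let Ω' : Set M := ((chartAt E p).source ∩
    (fun q => (⟨q, V q⟩ : TangentBundle 𝓘(ℝ, E) M)) ⁻¹' A) ∩ Ω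
  have ho : IsOpen Ω' := (hV.smooth.continuousOn.isOpen_inter_preimage
    (chartAt E p).open_source hL.conic.isOpen).inter hX.isOpen
  have hq : q ∈ Ω' := ⟨⟨h, by rw [mem_preimage, hVq]; exact hv⟩, hΩ⟩
  have hV' := hV.mono (Ω' := Ω') (fun x hx => hx.1.1) ho
  have hA : ∀ q ∈ Ω', (⟨q, V q⟩ : TangentBundle 𝓘(ℝ, E) M) ∈ A := fun x hx => hx.1.2
  have c1 : ChernAt L Ω' V q (nab.toFun ⟨q, V q⟩) :=
    ⟨fun X Y hX hY => hn.torsionFree Ω' V X Y hV' hA hX hY q hq,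
      fun X Y Z hX hY hZ => hn.almostCompatible Ω' V X Y Z hV' hA hX hY hZ q hq⟩
  have := chernAt_unique hL hV' hA hq (p := p) (fun x hx => hx.1.1) c1
    (chernAt_locNab hL hV' hA hq h) (hX.mono (fun x hx => hx.2) ho)
    (hY.mono (fun x hx => hx.2) ho)
  rwa [hVq] at this

/-- The covariant derivative in the chart around `γ t`. -/
lemma components_covariantDerivative (hL : IsPseudoFinsler A L) {nab : AnisotropicConnection A}
    (hn : IsChernConnection L nab) {U X : ∀ t : ℝ, TangentSpace 𝓘(ℝ, E) (γ t)}
    (hU : (⟨γ t, U t⟩ : TangentBundle 𝓘(ℝ, E) M) ∈ A) :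
    components (γ t) (γ t) (covariantDerivative nab a b γ U X t) =
      derivWithin (fun τ => components (E := E) (γ t) (γ τ) (X τ)) (Icc a b) t +
      chr (locG (locL L (γ t)) (pt (γ t) ⟨γ t, U t⟩))
        (fderiv ℝ (locG (locL L (γ t))) (pt (γ t) ⟨γ t, U t⟩)) (components (γ t) (γ t) (U t))
        (components (γ t) (γ t) (velocity a b γ t)) (components (γ t) (γ t) (X t)) := by
  have h := mem_chart_source E (γ t)
  have hc : ∀ w : E, fderiv ℝ (locX (γ t) (coordinateField (γ t) w))
      (extChartAt 𝓘(ℝ, E) (γ t) (γ t)) = 0 := by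
    intro w
    have ev : locX (γ t) (coordinateField (γ t) w) =ᶠ[𝓝 (extChartAt 𝓘(ℝ, E) (γ t) (γ t))]
        fun _ => w := by
      filter_upwards [(isOpen_extChartAt_target (γ t)).mem_nhds (ext_mem h)] with x hx
      exact comp_coord (symm_source hx) w
    rw [ev.fderiv_eq, fderiv_fun_const]; rfl
  rw [covariantDerivative, map_add, comp_coord h,
    hn.eq_locNab hL (coord_field (γ t) _) (coord_field (γ t) _) hU h h]
  congr 1
  refine (comp_locNab (v := ⟨γ t, U t⟩) h _ _).trans ?_
  simp only [locD, hc, comp_coord h, _root_.zero_apply, zero_add]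

/-- Along an admissible curve, `D (f γ̇) = f' γ̇ + f (v̇ + spr)` in the chart around `γ t`, with `spr`
the spray of `L`. -/
lemma components_covariantDerivative_smul_velocity (hL : IsPseudoFinsler A L)
    {nab : AnisotropicConnection A} (hn : IsChernConnection L nab)
    (hγ : IsAdmissibleCurve A a b γ) (hab : a < b) (ht : t ∈ Icc a b) {f : ℝ → ℝ} {f' : ℝ}
    (hf : HasDerivWithinAt f f' (Icc a b) t) :
    components (γ t) (γ t) (covariantDerivative nab a b γ (velocity a b γ)
        (fun τ => f τ • velocity a b γ τ) t) =
      f' • components (γ t) (γ t) (velocity a b γ t) +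
      f t • (derivWithin (fun τ => components (E := E) (γ t) (γ τ) (velocity a b γ τ)) (Icc a b) t +
        spr (locG (locL L (γ t)) (pt (γ t) (velocityLift a b γ t)))
          (fderiv ℝ (locG (locL L (γ t))) (pt (γ t) (velocityLift a b γ t)))
          (components (γ t) (γ t) (velocity a b γ t))) := by
  have h := mem_chart_source E (γ t)
  have hv := hγ.velocity_mem t ht
  have hz := pt_mem (p := γ t) hv h
  have hi := g_invertible hL hz
  have ks := k_symm hL hz
  have k0 : ∀ u w : E, fderiv ℝ (locG (locL L (γ t))) (pt (γ t) (velocityLift a b γ t)) (0, u) w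
      (components (γ t) (γ t) (velocity a b γ t)) = 0 := kv_zero hL hz
  have hw := (differentiableWithinAt_components_velocity hγ.smooth hab ht h).hasDerivWithinAt
  rw [components_covariantDerivative hL hn hv]
  simp only [map_smul]
  rw [← velocityLift, (hf.fun_smul hw).derivWithin (uniqueDiffOn_Icc hab t ht),
    chr_smul_right hi]
  -- `chr v v v = nl v = spr`, by Euler's relation for the Cartan tensor
  have := (chr_v hi ks k0 (components (γ t) (γ t) (velocity a b γ t))).trans (nl_self hi ks k0)
  erw [this]
  rw [smul_add]
  abel

/-- Along a lightlike curve the geodesic equation of `lam * L` is the equation `D (lam γ̇) = 0` for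
`L`: the left-hand sides become equal once their indices are lowered, the first with the fundamental
tensor of `lam * L`, the second with that of `L`. -/
lemma covariantDerivative_eq_zero_iff_of_lightlike {lam : TangentBundle 𝓘(ℝ, E) M → ℝ}
    (hL : IsPseudoFinsler A L) (hlam : ContMDiffOn 𝓘(ℝ, E).tangent 𝓘(ℝ, ℝ) ∞ lam A)
    (hlamL : IsPseudoFinsler A (fun v => lam v * L v))
    {nab nab' : AnisotropicConnection A} (hn : IsChernConnection L nab)
    (hn' : IsChernConnection (fun v => lam v * L v) nab')
    (hγ : IsLightlikeCurve A L a b γ) (hab : a < b) (ht : t ∈ Icc a b) :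
    covariantDerivative nab' a b γ (velocity a b γ) (velocity a b γ) t = 0 ↔
      covariantDerivative nab a b γ (velocity a b γ)
        (fun τ => lam (velocityLift a b γ τ) • velocity a b γ τ) t = 0 := by
  have h := mem_chart_source E (γ t)
  have hz := pt_mem (p := γ t) (hγ.admissible.velocity_mem t ht) h
  have hS := locS_open hL.conic.isOpen (γ t)
  have hl := locL_smooth hL (γ t)
  have hm := locL_contDiffOn hlam (γ t)
  have hdlam := hasDerivWithinAt_velocityLift hL.conic.isOpen hlam hγ.admissible hab ht h
  have hdL := hasDerivWithinAt_velocityLift hL.conic.isOpen hL.smooth hγ.admissible hab ht h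
  have e1 := components_covariantDerivative_smul_velocity hlamL hn' hγ.admissible hab ht
    (hasDerivWithinAt_const t (Icc a b) (1 : ℝ))
  simp only [one_smul, zero_smul, zero_add] at e1
  have e2 := components_covariantDerivative_smul_velocity hL hn hγ.admissible hab ht hdlam
  have el0 : lam (velocityLift a b γ t) = locL lam (γ t) (pt (γ t) (velocityLift a b γ t)) :=
    L_line (L := lam) (v := velocityLift a b γ t) h _
  have hL0 : locL L (γ t) (pt (γ t) (velocityLift a b γ t)) = 0 :=
    (L_line (L := L) (v := velocityLift a b γ t) h _).symm.trans (hγ.lightlike t ht)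
  -- `L` vanishes along the whole curve, so its derivative in the direction of the curve is zero
  -- too, at the endpoints because one-sided derivatives on `[a, b]` are unique.
  have hL1 := (uniqueDiffOn_Icc hab t ht).eq_deriv _ hdL
    ((hasDerivWithinAt_const t (Icc a b) (0 : ℝ)).congr hγ.lightlike (hγ.lightlike t ht))
  have hv : components (E := E) (γ t) (γ t) (velocity a b γ t) =
    (pt (γ t) (velocityLift a b γ t)).2 := rfl
  rw [hv] at e1 e2 hL1
  rw [el0] at e2
  set z := pt (γ t) (velocityLift (E := E) a b γ t)
  set w := derivWithin (fun τ => components (E := E) (γ t) (γ τ) (velocity a b γ τ)) (Icc a b) t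
  have key : ∀ Z : E,
      locG (locL (fun v => lam v * L v) (γ t)) z
        (components (γ t) (γ t)
          (covariantDerivative nab' a b γ (velocity a b γ) (velocity a b γ) t)) Z =
      locG (locL L (γ t)) z
        (components (γ t) (γ t) (covariantDerivative nab a b γ (velocity a b γ)
          (fun τ => lam (velocityLift a b γ τ) • velocity a b γ τ) t)) Z := by
    intro Z
    have k1 := locG_add_spr hS (locL_smooth hlamL (γ t)) (locL_homog hlamL (γ t)) hz
      (g_invertible hlamL hz) w Z
    have k2 := locG_add_spr hS hl (locL_homog hL (γ t)) hz (g_invertible hL hz) w Z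
    have k3 := locG_apply_self hS hl (locL_homog hL (γ t)) hz Z
    have k4 : eulerLagrange (locL (fun v => lam v * L v) (γ t)) z (z.2, w) Z = _ :=
      eulerLagrange_mul hS hm hl hz hL0 hL1 Z
    rw [e1, e2]
    simp only [map_add, map_smul, _root_.add_apply, _root_.smul_apply, smul_eq_mul] at k1 k2 ⊢
    rw [k4, ← k2, ← k3] at k1
    linarith
  constructor <;> intro h0
  · refine components_inj h (eq_of_g (g_invertible hL hz) fun Z => ?_)
    rw [← key, h0]
    simp
  · refine components_inj h (eq_of_g (g_invertible hlamL hz) fun Z => ?_)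
    rw [key, h0]
    simp

end Chart

end PseudoFinsler

theorem proposition3p2
    {E : Type*} [NormedAddCommGroup E] [NormedSpace ℝ E] [FiniteDimensional ℝ E]
    {M : Type*} [TopologicalSpace M] [ChartedSpace E M] [IsManifold 𝓘(ℝ, E) ∞ M]
    {A : Set (TangentBundle 𝓘(ℝ, E) M)} {L lam : TangentBundle 𝓘(ℝ, E) M → ℝ}
    (hL : PseudoFinsler.IsPseudoFinsler A L)
    (hlam_smooth : ContMDiffOn 𝓘(ℝ, E).tangent 𝓘(ℝ, ℝ) ∞ lam A)
    (hlam_pos : ∀ v ∈ A, 0 < lam v)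
    (hlam_homog : ∀ v ∈ A, ∀ c : ℝ, 0 < c → lam ⟨v.1, c • v.2⟩ = lam v)
    (hlamL : PseudoFinsler.IsPseudoFinsler A (fun v => lam v * L v))
    {a b : ℝ} (hab : a < b) (γ : ℝ → M) :
    (PseudoFinsler.IsGeodesic hlamL a b γ ∧
        PseudoFinsler.IsLightlikeCurve A (fun v => lam v * L v) a b γ) ↔
      (PseudoFinsler.IsLightlikeCurve A L a b γ ∧
        ∀ t ∈ Icc a b,
          PseudoFinsler.covariantDerivative (PseudoFinsler.chernConnection hL) a b γ
            (PseudoFinsler.velocity a b γ)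
            (fun τ => lam (PseudoFinsler.velocityLift a b γ τ) • PseudoFinsler.velocity a b γ τ)
            t = 0) := by
  have light : PseudoFinsler.IsLightlikeCurve A (fun v => lam v * L v) a b γ ↔
      PseudoFinsler.IsLightlikeCurve A L a b γ := by
    refine ⟨fun h => ⟨h.admissible, fun t ht => ?_⟩, fun h => ⟨h.admissible, fun t ht => ?_⟩⟩
    · exact (mul_eq_zero.1 (h.lightlike t ht)).resolve_left
        (hlam_pos _ (h.admissible.velocity_mem t ht)).ne'
    · simp only [h.lightlike t ht, mul_zero]
  have key := fun (h : PseudoFinsler.IsLightlikeCurve A L a b γ) (t : ℝ) (ht : t ∈ Icc a b) =>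
    PseudoFinsler.covariantDerivative_eq_zero_iff_of_lightlike hL hlam_smooth hlamL
      (PseudoFinsler.chernConnection_spec hL) (PseudoFinsler.chernConnection_spec hlamL) h hab ht
  constructor
  · rintro ⟨hg, hl⟩
    exact ⟨light.1 hl, fun t ht => (key (light.1 hl) t ht).1 (hg.geodesic t ht)⟩
  · rintro ⟨hl, hD⟩
    exact ⟨⟨hl.admissible, fun t ht => (key hl t ht).2 (hD t ht)⟩, light.2 hl⟩
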